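/- Let $p$ be an odd prime, $X=\mathbb F_p=\{0,1,\dots,p-1\}$, and let $X^*$ be the $p$-regular rooted tree whose vertices are the finite words over $X$ (each word $u$ being joined to the words $ux$, $x\in X$). Let $\mathbf e=(\mathbf e_1,\dots,\mathbf e_{p-1})\in\mathbb F_p^{p-1}$ be a non-constant tuple, and let $G\le\operatorname{Aut}(X^*)$ be the GGS-group with defining tuple $\mathbf e$, i.e. the group generated by the automorphism $a$ given by $a(xv)=(x+1)v$ for $x\in X$, $v\in X^*$, and the automorphism $b$ fixing every vertex of the first level and defined recursively by $b(0v)=0\,b(v)$ and $b(xv)=x\,a^{\mathbf e_x}(v)$ for $x\in\{1,\dots,p-1\}$, $v\in X^*$. Let $\mathbf e'=(\mathbf e_{i-1}-\mathbf e_i)_{2\le i\le p-1}\in\mathbb F_p^{p-2}$ be the tuple of differences of neighbouring entries of $\mathbf e$, and let $\mathbf e''=(\mathbf e'_{i-1}-\mathbf e'_i)_{3\le i\le p-1}\in\mathbb F_p^{p-3}$ be the tuple of differences of $\mathbf e'$ (the empty tuple if $p=3$). For a tuple $\mathbf d$ put $\operatorname{con}(\mathbf d)=1$ if all entries of $\mathbf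 d$ are equal and $\operatorname{con}(\mathbf d)=0$ otherwise, and put $\operatorname{sym}(\mathbf d)=1$ if for every $i$ the $i$-th entry of $\mathbf d$ equals its $i$-th-to-last entry and $\operatorname{sym}(\mathbf d)=0$ otherwise; in particular the empty tuple has $\operatorname{sym}=1$. Then the second derived subgroup $G''$ has finite index in $G$, and $$\log_p|G:G''| = p+1+\operatorname{con}(\mathbf e')+\operatorname{sym}(\mathbf e'')-\operatorname{sym}(\mathbf e).$$ -/

import Mathlib

namespace GGS

/-- The `p`-regular rooted tree: its vertices are the finite words over `X = ZMod p`, the root is the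
empty word, and a word `u` is joined to the words `u ++ [x]`, `x ∈ X`. -/
def tree (p : ℕ) : SimpleGraph (List (ZMod p)) where
  Adj u v := (∃ x, v = u ++ [x]) ∨ (∃ x, u = v ++ [x])
  symm := ⟨fun _ _ h => h.symm⟩
  loopless := ⟨fun u h => by
    rcases h with ⟨x, hx⟩ | ⟨x, hx⟩ <;> simpa using congrArg List.length hx⟩

/-- The group of graph automorphisms of the `p`-regular rooted tree. Automorphisms are composed as
functions, `(g * h) u = g (h u)`. -/
abbrev TreeAut (p : ℕ) : Type := tree p ≃g tree p

theorem adj_of_children {p : ℕ} {f : List (ZMod p) → List (ZMod p)}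
    (hf : ∀ u x, ∃ y, f (u ++ [x]) = f u ++ [y]) {u v : List (ZMod p)}
    (h : (tree p).Adj u v) : (tree p).Adj (f u) (f v) := by
  rcases h with ⟨x, rfl⟩ | ⟨x, rfl⟩
  · exact Or.inl (hf u x)
  · exact Or.inr (hf v x)

/-- A permutation of the words that, like its inverse, maps children of `u` to children of the image
of `u`, is an automorphism of the tree. -/
def autOfChildren {p : ℕ} (f g : List (ZMod p) → List (ZMod p))
    (hgf : ∀ u, g (f u) = u) (hfg : ∀ u, f (g u) = u)
    (hf : ∀ u x, ∃ y, f (u ++ [x]) = f u ++ [y])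
    (hg : ∀ u x, ∃ y, g (u ++ [x]) = g u ++ [y]) : TreeAut p where
  toFun := f
  invFun := g
  left_inv := hgf
  right_inv := hfg
  map_rel_iff' := by
    intro u v
    refine ⟨fun h => ?_, fun h => adj_of_children hf h⟩
    have h2 := adj_of_children hg h
    simpa [hgf] using h2

/-- The map that adds `k` to the first letter of a word. -/
def shiftFun {p : ℕ} (k : ZMod p) : List (ZMod p) → List (ZMod p)
  | [] => []
  | x :: v => (x + k) :: v

theorem shiftFun_child {p : ℕ} (k : ZMod p) (u : List (ZMod p)) (x : ZMod p) :
    ∃ y, shiftFun k (u ++ [x]) = shiftFun k u ++ [y] := by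
  cases u <;> simp [shiftFun]

theorem shiftFun_shiftFun {p : ℕ} (k l : ZMod p) (u : List (ZMod p)) :
    shiftFun k (shiftFun l u) = shiftFun (l + k) u := by
  cases u <;> simp [shiftFun, add_assoc]

theorem shiftFun_zero {p : ℕ} (u : List (ZMod p)) : shiftFun 0 u = u := by
  cases u <;> simp [shiftFun]

/-- The rooted automorphism that permutes the first letters by the `k`-th power of
`(0 1 … p-1)`. -/
def rooted {p : ℕ} (k : ZMod p) : TreeAut p :=
  autOfChildren (shiftFun k) (shiftFun (-k))
    (fun u => by simp [shiftFun_shiftFun, shiftFun_zero])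
    (fun u => by simp [shiftFun_shiftFun, shiftFun_zero])
    (shiftFun_child k) (shiftFun_child (-k))

/-- The rooted generator `a = (0 1 … p-1)`. -/
def genA (p : ℕ) : TreeAut p := rooted 1

theorem rooted_natCast {p : ℕ} (n : ℕ) : rooted (n : ZMod p) = genA p ^ n := by
  induction n with
  | zero => ext1 u; rw [Nat.cast_zero]; exact shiftFun_zero u
  | succ n ih =>
    rw [pow_succ, ← ih]
    ext1 u
    change shiftFun _ u = shiftFun _ (shiftFun _ u)
    rw [shiftFun_shiftFun]
    push_cast
    rw [add_comm]

/-- For a tuple `e = (e₁, …, e_{p-1})`, stored as `e 0, …, e (p-2)`, and a letter `x`: the entry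
`e_x` if `x ≠ 0`, and `0` if `x = 0`. -/
def entry {p : ℕ} (e : Fin (p - 1) → ZMod p) (x : ZMod p) : ZMod p :=
  if h : x.val - 1 < p - 1 ∧ x ≠ 0 then e ⟨x.val - 1, h.1⟩ else 0

/-- The map fixing all first-level vertices, which acts below the vertex `0` as itself and
below a vertex `x ≠ 0` as `a ^ e_x`. -/
def directedFun {p : ℕ} (e : Fin (p - 1) → ZMod p) : List (ZMod p) → List (ZMod p)
  | [] => []
  | x :: v => if x = 0 then x :: directedFun e v else x :: rooted (entry e x) v

theorem directedFun_child {p : ℕ} (e : Fin (p - 1) → ZMod p) (u : List (ZMod p)) (x : ZMod p) :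
    ∃ y, directedFun e (u ++ [x]) = directedFun e u ++ [y] := by
  induction u with
  | nil =>
    refine ⟨x, ?_⟩
    by_cases h : x = 0
    · simp [directedFun, h]
    · simp only [List.nil_append, directedFun, h, if_false]
      rfl
  | cons z v ih =>
    by_cases h : z = 0
    · simpa [directedFun, h] using ih
    · obtain ⟨y, hy⟩ := shiftFun_child (entry e z) v x
      refine ⟨y, ?_⟩
      simp only [List.cons_append, directedFun, h, if_false]
      exact congrArg (z :: ·) hy

theorem directedFun_neg {p : ℕ} (e : Fin (p - 1) → ZMod p) (u : List (ZMod p)) :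
    directedFun (-e) (directedFun e u) = u := by
  induction u with
  | nil => rfl
  | cons z v ih =>
    by_cases h : z = 0
    · simpa [directedFun, h] using ih
    · have hn : entry (-e) z = -entry e z := by
        unfold entry
        split_ifs <;> simp
      simp only [directedFun, h, if_false, hn, List.cons.injEq, true_and]
      change shiftFun _ (shiftFun _ v) = v
      simp [shiftFun_shiftFun, shiftFun_zero]

/-- The directed generator `b = ψ⁻¹(b, a ^ e₁, …, a ^ e_{p-1})`. -/
def genB {p : ℕ} (e : Fin (p - 1) → ZMod p) : TreeAut p :=
  autOfChildren (directedFun e) (directedFun (-e)) (directedFun_neg e)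
    (fun u => by simpa using directedFun_neg (-e) u)
    (directedFun_child e) (directedFun_child (-e))

theorem genB_cons_zero {p : ℕ} (e : Fin (p - 1) → ZMod p) (v : List (ZMod p)) :
    genB e (0 :: v) = 0 :: genB e v := by
  change directedFun e _ = 0 :: directedFun e v
  simp [directedFun]

theorem genB_cons {p : ℕ} [Fact p.Prime] (e : Fin (p - 1) → ZMod p) (i : Fin (p - 1))
    (v : List (ZMod p)) :
    genB e (((i + 1 : ℕ) : ZMod p) :: v) =
      ((i + 1 : ℕ) : ZMod p) :: (genA p ^ (e i).val) v := by
  have hv : (((i + 1 : ℕ) : ZMod p)).val = i + 1 := ZMod.val_natCast_of_lt (by omega)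
  have h0 : ((i + 1 : ℕ) : ZMod p) ≠ 0 := by
    intro h
    rw [h] at hv
    simp at hv
  have he : entry e ((i + 1 : ℕ) : ZMod p) = e i := by
    unfold entry
    rw [dif_pos ⟨by rw [hv]; simp, h0⟩]
    congr 1
    ext
    simp only [hv]
    omega
  change directedFun e _ = _
  rw [directedFun, if_neg h0, he, ← rooted_natCast, ZMod.natCast_zmod_val]

/-- The group `G_e = ⟨a, b⟩` generated by the rooted and the directed generator; it is the GGS-group
with defining tuple `e` when `e` is non-constant. -/
def ggsGroup {p : ℕ} (e : Fin (p - 1) → ZMod p) : Subgroup (TreeAut p) :=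
  Subgroup.closure {genA p, genB e}

/-- The tuple `(d₁ - d₂, d₂ - d₃, …, d_{n-1} - d_n)` of differences of neighbouring entries. -/
def diff {R : Type*} [Sub R] {n : ℕ} (d : Fin n → R) : Fin (n - 1) → R :=
  fun i => d ⟨i, by omega⟩ - d ⟨i + 1, by omega⟩

/-- All entries of the tuple are equal. -/
def IsConstant {R : Type*} {n : ℕ} (d : Fin n → R) : Prop := ∀ i j, d i = d j

/-- The `i`-th entry of the tuple equals its `i`-th-to-last entry. -/
def IsSymmetric {R : Type*} {n : ℕ} (d : Fin n → R) : Prop := ∀ i, d i = d i.rev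

open Classical in
/-- `1` for constant tuples, `0` for the others. -/
noncomputable def con {R : Type*} {n : ℕ} (d : Fin n → R) : ℕ := if IsConstant d then 1 else 0

open Classical in
/-- `1` for symmetric tuples, `0` for the others. -/
noncomputable def sym {R : Type*} {n : ℕ} (d : Fin n → R) : ℕ := if IsSymmetric d then 1 else 0

end GGS

/-! The argument takes place in an abstract group Γ with the wreath recursion of a GGS-group; `E` is
the defining tuple extended by `E 0 = 0`. Let S be the first-level stabilizer and b_i the conjugate
of `b` by a^i. The b_i form a basis of S/S' = F_p^p (coordinates `xvec`), so |Γ : S'| = p^(p+1), and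
Γ'' ≤ S'.

Since the tuple is not constant, Γ maps onto a Heisenberg group with coordinates (`root`, `ε`, `η`),
and the kernel K of this map is the third term of the lower central series (`nonempty_heisenberg`,
`kernel_le`). The sections of an element of S' have `root = ε = 0`, so their `η`-coordinates form a
homomorphism `rho` from S' to F_p^p. As `η` of a commutator is a symplectic form in (`root`, `ε`),
`rho ⁅g, h⁆` is a bilinear expression `commForm` in `xvec g` and `xvec h`.

The geometric core is `kernel_le_rigid`: Γ'' contains every element that acts as some k ∈ K below
one first-level vertex and trivially elsewhere. Hence ker `rho` ≤ Γ'', and |S' : Γ''| can be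
computed in F_p^p: it compares the span of `commForm` over all vectors (the image of S) with the
span over vectors of sum zero (the image of Γ'). This is `index_formula`. To obtain
`kernel_le_rigid`, note that ⁅b_0, b_m⁆ has nontrivial sections at most at 0 and m. Its commutator
with an element whose section at m is trivial lives at 0 alone. Suitable products of the b_i make
this commutator generate enough of K; the symmetric and the non-symmetric case need different
choices.

The codimensions of the spans are dimensions of annihilators. The full span has codimension sym(e)
(`index_commSpan_top`). The annihilator of the sum-zero span is invariant under a nilpotent
difference operator, hence a space of polynomials of bounded degree; testing 1, k and k^2 gives
con(e') + sym(e'') (`index_commSpan_sumZero`). -/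

namespace GGS

open Finset
open scoped commutatorElement

/-! ### Linear algebra: codimensions of spans of commutator forms. -/

section LinearAlgebra

variable {p : ℕ} [Fact p.Prime]

/-- The cyclic convolution of two functions on `ZMod p`. -/
def conv (E x : ZMod p → ZMod p) : ZMod p → ZMod p := fun k => ∑ i, x i * E (k - i)

/-- The commutator form of the circulant matrix of `E`. -/
def commForm (E x y : ZMod p → ZMod p) : ZMod p → ZMod p :=
  fun k => conv E x k * y k - conv E y k * x k

/-- The span of the values of the commutator form on a subspace. -/
def commSpan (E : ZMod p → ZMod p) (A : Submodule (ZMod p) (ZMod p → ZMod p)) :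
    Submodule (ZMod p) (ZMod p → ZMod p) :=
  Submodule.span _ {v | ∃ x ∈ A, ∃ y ∈ A, commForm E x y = v}

/-- The vectors with vanishing sum. -/
def sumZero (p : ℕ) [Fact p.Prime] : Submodule (ZMod p) (ZMod p → ZMod p) where
  carrier := {v | ∑ k, v k = 0}
  add_mem' := by
    intro v w hv hw
    simp only [Set.mem_ofPred_eq, Pi.add_apply, sum_add_distrib] at *
    rw [hv, hw, add_zero]
  zero_mem' := by simp
  smul_mem' := by
    intro c v hv
    simp only [Set.mem_ofPred_eq, Pi.smul_apply, smul_eq_mul, ← mul_sum] at *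
    rw [hv, mul_zero]

theorem mem_sumZero {v : ZMod p → ZMod p} : v ∈ sumZero p ↔ ∑ k, v k = 0 := Iff.rfl

theorem conv_single (E : ZMod p → ZMod p) (i c k : ZMod p) :
    conv E (Pi.single i c) k = c * E (k - i) := by
  simp [conv, Pi.single_apply]

theorem conv_sub (E x y : ZMod p → ZMod p) (k : ZMod p) :
    conv E (x - y) k = conv E x k - conv E y k := by
  simp [conv, sub_mul, sum_sub_distrib]

theorem conv_add (E x y : ZMod p → ZMod p) (k : ZMod p) :
    conv E (x + y) k = conv E x k + conv E y k := by
  simp [conv, add_mul, sum_add_distrib]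

theorem conv_shift (E x : ZMod p → ZMod p) (k c : ZMod p) :
    conv E (fun i => x (i + c)) k = conv E x (k + c) := by
  unfold conv
  rw [← Equiv.sum_comp (Equiv.addRight c) (fun i => x i * E (k + c - i))]
  refine sum_congr rfl fun i _ => ?_
  simp

/-- The functionals that vanish on a subspace, given by their coefficients. -/
def annihilator (W : Submodule (ZMod p) (ZMod p → ZMod p)) :
    Submodule (ZMod p) (ZMod p → ZMod p) :=
  (Matrix.toBilin' (1 : Matrix (ZMod p) (ZMod p) (ZMod p))).orthogonal W

theorem mem_annihilator {W : Submodule (ZMod p) (ZMod p → ZMod p)} {l : ZMod p → ZMod p} :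
    l ∈ annihilator W ↔ ∀ w ∈ W, ∑ k, l k * w k = 0 := by
  unfold annihilator
  rw [LinearMap.BilinForm.mem_orthogonal_iff]
  refine forall₂_congr fun w _ => ?_
  rw [Matrix.toBilin'_apply']
  simp [dotProduct, mul_comm]

/-- The dot product is nondegenerate, so the annihilator has the dimension of the quotient by `W`;
counting elements turns this into an index. -/
theorem index_eq_of_annihilator (W : Submodule (ZMod p) (ZMod p → ZMod p)) :
    W.toAddSubgroup.index = p ^ Module.finrank (ZMod p) (annihilator W) := by
  have hnd : (Matrix.toBilin' (1 : Matrix (ZMod p) (ZMod p) (ZMod p))).Nondegenerate :=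
    Matrix.Nondegenerate.toBilin' (Matrix.nondegenerate_of_det_ne_zero (by simp))
  have h1 := LinearMap.BilinForm.finrank_orthogonal hnd W
  have h2 : Module.finrank (ZMod p) W ≤ Module.finrank (ZMod p) (ZMod p → ZMod p) :=
    Submodule.finrank_le W
  have h3 := W.toAddSubgroup.index_mul_card
  have h4 : Nat.card W.toAddSubgroup = p ^ Module.finrank (ZMod p) W := by
    have := Module.natCard_eq_pow_finrank (K := ZMod p) (V := W)
    rwa [Nat.card_zmod] at this
  have h5 : Nat.card (ZMod p → ZMod p) = p ^ Module.finrank (ZMod p) (ZMod p → ZMod p) := by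
    have := Module.natCard_eq_pow_finrank (K := ZMod p) (V := ZMod p → ZMod p)
    rwa [Nat.card_zmod] at this
  have hp : 0 < p := (Fact.out : p.Prime).pos
  unfold annihilator
  rw [h1]
  rw [h4, h5] at h3
  refine Nat.eq_of_mul_eq_mul_right (pow_pos hp (Module.finrank (ZMod p) W)) ?_
  rw [h3, ← pow_add]
  congr 1
  omega

/-- Pairing `commForm` with `l` is a bilinear form in `x`, `y` whose matrix is antisymmetric, so
lying in the annihilator becomes a condition on matrix entries. -/
theorem sum_mul_commForm (E x y l : ZMod p → ZMod p) :
    ∑ k, l k * commForm E x y k =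
      ∑ k, ∑ i, x i * y k * (l k * E (k - i) - l i * E (i - k)) := by
  have h1 : ∑ k, l k * (conv E y k * x k) = ∑ k, ∑ i, x i * y k * (l i * E (i - k)) := by
    rw [sum_comm]
    refine sum_congr rfl fun k _ => ?_
    simp only [conv, sum_mul, mul_sum]
    refine sum_congr rfl fun i _ => ?_
    ring
  have h2 : ∑ k, l k * (conv E x k * y k) = ∑ k, ∑ i, x i * y k * (l k * E (k - i)) := by
    refine sum_congr rfl fun k _ => ?_
    simp only [conv, sum_mul, mul_sum]
    refine sum_congr rfl fun i _ => ?_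
    ring
  simp only [commForm, mul_sub, sum_sub_distrib, h1, h2]

theorem mem_annihilator_commSpan {E l : ZMod p → ZMod p}
    {A : Submodule (ZMod p) (ZMod p → ZMod p)} :
    l ∈ annihilator (commSpan E A) ↔
      ∀ x ∈ A, ∀ y ∈ A, ∑ k, ∑ i, x i * y k * (l k * E (k - i) - l i * E (i - k)) = 0 := by
  rw [mem_annihilator]
  constructor
  · intro h x hx y hy
    rw [← sum_mul_commForm]
    exact h _ (Submodule.subset_span ⟨x, hx, y, hy, rfl⟩)
  · intro h w hw
    induction hw using Submodule.span_induction with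
    | mem w hw =>
      obtain ⟨x, hx, y, hy, rfl⟩ := hw
      rw [sum_mul_commForm]
      exact h x hx y hy
    | zero => simp
    | add v w _ _ hv hw => simp [mul_add, sum_add_distrib, hv, hw]
    | smul c v _ hv =>
      have : ∀ k, l k * (c • v) k = c * (l k * v k) := fun k => by
        simp only [Pi.smul_apply, smul_eq_mul]; ring
      simp only [this, ← mul_sum, hv, mul_zero]

theorem mem_annihilator_commSpan_top {E l : ZMod p → ZMod p} :
    l ∈ annihilator (commSpan E ⊤) ↔ ∀ j m, l (j + m) * E m = l j * E (-m) := by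
  rw [mem_annihilator_commSpan]
  constructor
  · intro h j m
    have := h (Pi.single j 1) trivial (Pi.single (j + m) 1) trivial
    rw [sum_eq_single (j + m) (fun k _ hk => by simp [Pi.single_apply, hk]) (by simp),
      sum_eq_single j (fun k _ hk => by simp [hk]) (by simp),
      Pi.single_eq_same, Pi.single_eq_same, one_mul, one_mul] at this
    have h2 : j - (j + m) = -m := by ring
    rw [add_sub_cancel_left, h2] at this
    exact sub_eq_zero.mp this
  · intro h x _ y _
    refine sum_eq_zero fun k _ => sum_eq_zero fun i _ => ?_
    have := h i (k - i)
    rw [add_sub_cancel, neg_sub] at this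
    rw [this, sub_self, mul_zero]

/-- A bilinear form vanishes on pairs of sum-zero vectors exactly if its matrix is a function of the
row plus a function of the column; antisymmetry makes this a difference `α k - α i`. -/
theorem mem_annihilator_commSpan_sumZero {E l : ZMod p → ZMod p} :
    l ∈ annihilator (commSpan E (sumZero p)) ↔
      ∃ α : ZMod p → ZMod p, ∀ j m, l (j + m) * E m - l j * E (-m) = α (j + m) - α j := by
  rw [mem_annihilator_commSpan]
  constructor
  · intro h
    -- `α` is row 0 of the matrix; the form is tested on differences with the basis vector at 0.
    refine ⟨fun k => l k * E k - l 0 * E (-k), fun j m => ?_⟩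
    have hs : ∀ i : ZMod p, Pi.single i 1 - Pi.single 0 1 ∈ sumZero p := fun i => by
      simp [mem_sumZero, sum_sub_distrib]
    have := h _ (hs j) _ (hs (j + m))
    have e1 : ∀ k i : ZMod p, (Pi.single j 1 - Pi.single 0 1 : ZMod p → ZMod p) i *
        (Pi.single (j + m) 1 - Pi.single 0 1 : ZMod p → ZMod p) k *
          (l k * E (k - i) - l i * E (i - k)) =
        (if i = j then (if k = j + m then (l k * E (k - i) - l i * E (i - k)) else 0) else 0)
        - (if i = j then (if k = 0 then (l k * E (k - i) - l i * E (i - k)) else 0) else 0)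
        - (if i = 0 then (if k = j + m then (l k * E (k - i) - l i * E (i - k)) else 0) else 0)
        + (if i = 0 then (if k = 0 then (l k * E (k - i) - l i * E (i - k)) else 0) else 0) := by
      intro k i
      simp only [Pi.sub_apply, Pi.single_apply]
      split_ifs <;> ring
    simp only [e1, sum_add_distrib, sum_sub_distrib, sum_ite_eq', mem_univ, if_true] at this
    have h2 : j - (j + m) = -m := by ring
    rw [add_sub_cancel_left, h2] at this
    simp only [sub_zero, zero_sub, sub_self, add_zero] at this
    linear_combination this
  · rintro ⟨α, h⟩ x hx y hy
    rw [mem_sumZero] at hx hy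
    have h1 : ∀ k i : ZMod p, x i * y k * (l k * E (k - i) - l i * E (i - k)) =
        x i * (y k * α k) - (x i * α i) * y k := by
      intro k i
      have := h i (k - i)
      rw [add_sub_cancel, neg_sub] at this
      rw [this]
      ring
    simp only [h1, sum_sub_distrib, ← sum_mul, ← mul_sum, hx, hy]
    simp

-- For `E m ≠ 0` an annihilating `l` is multiplied by w = E(-m)/E(m) under translation by `m`. After
-- `p` translations w^p = w must be 1 unless `l = 0`. So `l` is constant if `E` is even, and zero if
-- some ratio differs from 1.
open Classical in
theorem index_commSpan_top {E : ZMod p → ZMod p} (h0 : E 0 = 0) (hE : ∃ m, E m ≠ 0) :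
    (commSpan E ⊤).toAddSubgroup.index = p ^ (if ∀ m, E (-m) = E m then 1 else 0) := by
  have key : ∀ (l : ZMod p → ZMod p) (w m : ZMod p), (∀ j, l (j + m) = w * l j) →
      ∀ (n : ℕ) (j : ZMod p), l (j + n * m) = w ^ n * l j := by
    intro l w m h n
    induction n with
    | zero => simp
    | succ n ih =>
      intro j
      have : j + ((n + 1 : ℕ) : ZMod p) * m = (j + n * m) + m := by push_cast; ring
      rw [this, h, ih]
      ring
  rw [index_eq_of_annihilator]
  congr 1
  split_ifs with hs
  · have : annihilator (commSpan E ⊤) = Submodule.span (ZMod p) {fun _ => (1 : ZMod p)} := by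
      ext l
      rw [mem_annihilator_commSpan_top, Submodule.mem_span_singleton]
      constructor
      · intro h
        obtain ⟨m, hm⟩ := hE
        have hm0 : m ≠ 0 := fun h => hm (by rw [h, h0])
        have h1 : ∀ j, l (j + m) = 1 * l j := fun j => by
          have := h j m
          rw [hs] at this
          rw [one_mul]
          exact mul_right_cancel₀ hm this
        refine ⟨l 0, funext fun k => ?_⟩
        have h2 := key l 1 m h1 (k / m).val 0
        rw [ZMod.natCast_zmod_val, div_mul_cancel₀ _ hm0, zero_add, one_pow, one_mul] at h2
        simp [h2]
      · rintro ⟨c, rfl⟩ j m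
        simp [hs]
    rw [this, finrank_span_singleton]
    intro h
    exact one_ne_zero (congrFun h 0)
  · rw [show annihilator (commSpan E ⊤) = ⊥ from ?_, finrank_bot]
    rw [Submodule.eq_bot_iff]
    intro l hl
    rw [mem_annihilator_commSpan_top] at hl
    have : ∃ m, E m ≠ 0 ∧ E (-m) ≠ E m := by
      push Not at hs
      obtain ⟨m, hm⟩ := hs
      by_cases h : E m = 0
      · exact ⟨-m, by rwa [← h], by rw [neg_neg]; exact hm.symm⟩
      · exact ⟨m, h, hm⟩
    obtain ⟨m, hm, hm'⟩ := this
    have h1 : ∀ j, l (j + m) = (E (-m) / E m) * l j := fun j => by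
      have := hl j m
      field_simp
      linear_combination this
    funext j
    have h2 := key l _ m h1 p j
    rw [CharP.cast_eq_zero, zero_mul, add_zero, ZMod.pow_card] at h2
    have h3 : E (-m) / E m ≠ 1 := fun h => hm' ((div_eq_one_iff_eq hm).mp h)
    have h4 : (E (-m) / E m - 1) * l j = 0 := by linear_combination -h2
    exact (mul_eq_zero.mp h4).resolve_left (sub_ne_zero.mpr h3)

/-- The difference operator on functions on `ZMod p`. -/
def shiftDiff (p : ℕ) : (ZMod p → ZMod p) →ₗ[ZMod p] (ZMod p → ZMod p) where
  toFun l := fun k => l (k + 1) - l k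
  map_add' := by intro l m; funext k; simp; ring
  map_smul' := by intro c l; funext k; simp; ring

theorem shiftDiff_apply (l : ZMod p → ZMod p) (k : ZMod p) :
    shiftDiff p l k = l (k + 1) - l k := rfl

/-- In characteristic p, (s - 1)^p = s^p - 1, and the shift s has order p. -/
theorem shiftDiff_pow_prime (l : ZMod p → ZMod p) : (shiftDiff p ^ p) l = 0 := by
  set s : Module.End (ZMod p) (ZMod p → ZMod p) := LinearMap.funLeft (ZMod p) (ZMod p) (· + 1)
  have hs : shiftDiff p = s - 1 := rfl
  have : Nontrivial (Module.End (ZMod p) (ZMod p → ZMod p)) := inferInstance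
  have : CharP (Module.End (ZMod p) (ZMod p → ZMod p)) p := charP_of_injective_algebraMap
    (algebraMap (ZMod p) (Module.End (ZMod p) (ZMod p → ZMod p))).injective p
  have hn : ∀ (n : ℕ) (k : ZMod p), (s ^ n) l k = l (k + n) := by
    intro n
    induction n with
    | zero => simp
    | succ n ih =>
      intro k
      rw [pow_succ']
      change (s ^ n) l (k + 1) = _
      rw [ih]
      push_cast
      ring_nf
  rw [hs, sub_pow_char_of_commute p (Commute.one_right s)]
  funext k
  rw [LinearMap.sub_apply, Pi.sub_apply, hn]
  simp

/-- The difference operator lowers polynomial degree by one, so an invariant subspace with an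
element of degree at least `n` contains one of degree exactly `n`: difference as often as possible.
-/
theorem exists_shiftDiff_pow (L : Submodule (ZMod p) (ZMod p → ZMod p))
    (hL : ∀ l ∈ L, shiftDiff p l ∈ L) {l : ZMod p → ZMod p} (hl : l ∈ L) (n : ℕ)
    (hn : (shiftDiff p ^ n) l ≠ 0) :
    ∃ l' ∈ L, (shiftDiff p ^ n) l' ≠ 0 ∧ (shiftDiff p ^ (n + 1)) l' = 0 := by
  classical
  have hex : ∃ t, (shiftDiff p ^ (n + t)) l = 0 := ⟨p, by
    rw [pow_add, Module.End.mul_apply, shiftDiff_pow_prime, map_zero]⟩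
  have hpos : Nat.find hex ≠ 0 := by
    intro h
    have := Nat.find_spec hex
    rw [h] at this
    exact hn this
  obtain ⟨t, ht⟩ := Nat.exists_eq_succ_of_ne_zero hpos
  have h1 := Nat.find_spec hex
  have h2 := Nat.find_min hex (m := t) (by omega)
  rw [ht] at h1
  refine ⟨(shiftDiff p ^ t) l, ?_, ?_, ?_⟩
  · clear h1 h2 ht
    induction t with
    | zero => simpa
    | succ t ih =>
      rw [pow_succ', Module.End.mul_apply]
      exact hL _ ih
  · rwa [← Module.End.mul_apply, ← pow_add]
  · rw [← Module.End.mul_apply, ← pow_add]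
    convert h1 using 3
    omega

theorem eq_affine_of_sub_eq {l : ZMod p → ZMod p} {c : ZMod p} (h : ∀ k, l (k + 1) - l k = c) (k) :
    l k = l 0 + c * k := by
  have : ∀ n : ℕ, l n = l 0 + c * n := by
    intro n
    induction n with
    | zero => simp
    | succ n ih =>
      have := h n
      push_cast
      linear_combination this + ih
  have h2 := this k.val
  rwa [ZMod.natCast_zmod_val] at h2

theorem eq_const_of_shiftDiff {l : ZMod p → ZMod p} (h : shiftDiff p l = 0) (k) : l k = l 0 := by
  have := eq_affine_of_sub_eq (c := 0) (fun k => congrFun h k) k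
  rwa [zero_mul, add_zero] at this

theorem eq_affine_of_shiftDiff {l : ZMod p → ZMod p} (h : (shiftDiff p ^ 2) l = 0) (k) :
    l k = l 0 + shiftDiff p l 0 * k :=
  eq_affine_of_sub_eq (fun k => eq_const_of_shiftDiff (l := shiftDiff p l)
    (by rwa [pow_two] at h) k) k

theorem eq_quadratic_of_shiftDiff (hp : p ≠ 2) {l : ZMod p → ZMod p}
    (h : (shiftDiff p ^ 3) l = 0) (k) :
    l k = l 0 + (shiftDiff p l 0 - shiftDiff p (shiftDiff p l) 0 / 2) * k
      + shiftDiff p (shiftDiff p l) 0 / 2 * k ^ 2 := by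
  have h2 : (2 : ZMod p) ≠ 0 := by
    have := ZMod.prime_ne_zero p 2 hp
    exact_mod_cast this
  set d := shiftDiff p (shiftDiff p l) 0
  have h1 : ∀ k, shiftDiff p l k = shiftDiff p l 0 + d * k :=
    eq_affine_of_shiftDiff (l := shiftDiff p l) (by rwa [pow_succ] at h)
  -- The difference of `k ^ 2` is 2k + 1, so subtracting (d/2)k^2 leaves a function with constant
  -- difference.
  have := eq_affine_of_sub_eq (l := fun k => l k - d / 2 * k ^ 2) (c := shiftDiff p l 0 - d / 2)
    (fun k => by
      have := h1 k
      rw [shiftDiff_apply l k] at this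
      field_simp
      linear_combination 2 * this) k
  linear_combination this

section SumZero

variable {E : ZMod p → ZMod p}

/-- The matrix condition is invariant under translating `l` and `α` together. -/
theorem shiftDiff_mem_annihilator {l : ZMod p → ZMod p}
    (hl : l ∈ annihilator (commSpan E (sumZero p))) :
    shiftDiff p l ∈ annihilator (commSpan E (sumZero p)) := by
  rw [mem_annihilator_commSpan_sumZero] at *
  obtain ⟨α, h⟩ := hl
  refine ⟨shiftDiff p α, fun j m => ?_⟩
  have h1 := h j m
  have h2 := h (j + 1) m
  rw [add_right_comm] at h2
  simp only [shiftDiff_apply]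
  linear_combination h2 - h1

/-- For `l = 1` the increments of `α` do not depend on the base point, so `α` is affine. -/
theorem one_mem_annihilator_iff :
    (fun _ => 1) ∈ annihilator (commSpan E (sumZero p)) ↔ ∃ κ, ∀ m, E m - E (-m) = κ * m := by
  rw [mem_annihilator_commSpan_sumZero]
  constructor
  · rintro ⟨α, h⟩
    have h1 := eq_affine_of_sub_eq (l := α) (c := E 1 - E (-1)) (fun k => by
      have := h k 1
      linear_combination -this)
    refine ⟨E 1 - E (-1), fun m => ?_⟩
    have h2 := h 0 m
    rw [h1 (0 + m)] at h2
    rw [zero_add] at h2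
    linear_combination h2
  · rintro ⟨κ, h⟩
    refine ⟨fun k => κ * k, fun j m => ?_⟩
    linear_combination h m

theorem id_mem_annihilator_iff (hp : p ≠ 2) (h0 : E 0 = 0)
    (h1 : (fun _ => 1) ∈ annihilator (commSpan E (sumZero p))) :
    (fun k => k) ∈ annihilator (commSpan E (sumZero p)) ↔
      ∃ u κ, ∀ m, m ≠ 0 → E m = u + κ * m := by
  have h2 : (2 : ZMod p) ≠ 0 := by
    have := ZMod.prime_ne_zero p 2 hp
    exact_mod_cast this
  rw [one_mem_annihilator_iff] at h1
  obtain ⟨κ, hκ⟩ := h1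
  rw [mem_annihilator_commSpan_sumZero]
  constructor
  · rintro ⟨α, h⟩
    have h3 : ∀ k, α k = k * E k + α 0 := fun k => by
      have := h 0 k
      rw [zero_add] at this
      linear_combination -this
    -- The increment of `k * E k` is `κ * k + E 1`, so `k * E k` is quadratic with no constant term;
    -- dividing by `k` makes `E` affine off 0.
    have h4 := eq_affine_of_sub_eq (l := fun k => k * E k - κ / 2 * k ^ 2) (c := E 1 - κ / 2)
      (fun k => by
        have e1 := h k 1
        rw [h3 (k + 1), h3 k] at e1
        have e2 := hκ 1
        field_simp
        linear_combination -2 * e1 + 2 * k * e2)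
    refine ⟨E 1 - κ / 2, κ / 2, fun m hm => mul_left_cancel₀ hm ?_⟩
    have := h4 m
    linear_combination this
  · rintro ⟨u, c, h⟩
    have h' : ∀ m, m * E m = m * (u + c * m) := fun m => by
      by_cases hm : m = 0
      · simp [hm]
      · rw [h m hm]
    refine ⟨fun k => k * E k, fun j m => ?_⟩
    have e : ∀ m, m ≠ 0 → E (-m) = u - c * m := fun m hm => by
      rw [h _ (neg_ne_zero.mpr hm)]; ring
    change _ = (j + m) * E (j + m) - j * E j
    rw [h' (j + m), h' j]
    by_cases hm : m = 0
    · subst hm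
      simp [h0]
    · rw [h m hm, e m hm]
      ring

theorem sq_notMem_annihilator (hp : p ≠ 2) {u κ : ZMod p}
    (hκ : κ ≠ 0) (h : ∀ m, m ≠ 0 → E m = u + κ * m) :
    (fun k => k ^ 2) ∉ annihilator (commSpan E (sumZero p)) := by
  have h2 : (2 : ZMod p) ≠ 0 := by
    have := ZMod.prime_ne_zero p 2 hp
    exact_mod_cast this
  rw [mem_annihilator_commSpan_sumZero]
  rintro ⟨α, hα⟩
  -- The increment of `α` from 0 to 2 must be the sum of those from 0 to 1 and from 1 to 2; the
  -- discrepancy is 2κ.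
  have e0 := hα 0 1
  have e1 := hα 0 2
  have e2 := hα 1 1
  have h3 : E (-1) = u - κ := by
    rw [h _ (neg_ne_zero.mpr one_ne_zero)]; ring
  have h12 : (1 : ZMod p) + 1 = 2 := by norm_num
  simp only [zero_add] at e0 e1
  rw [h _ one_ne_zero, h3] at e0
  rw [h _ h2] at e1
  rw [h12, h _ one_ne_zero, h3] at e2
  have : κ * 2 = 0 := by linear_combination e1 - e2 - e0
  exact mul_ne_zero hκ h2 this

-- The annihilator `L` is invariant under differences. If nonzero it contains 1, if it has a
-- nonconstant element it contains k, and an element of higher degree would force k^2 into it, which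
-- is impossible. So its dimension counts which of 1 and k it contains.
open Classical in
theorem index_commSpan_sumZero (hp : p ≠ 2) (h0 : E 0 = 0)
    (hE : ¬ ∃ u, ∀ m, m ≠ 0 → E m = u) :
    (commSpan E (sumZero p)).toAddSubgroup.index =
      p ^ ((if ∃ u κ, ∀ m, m ≠ 0 → E m = u + κ * m then 1 else 0) +
        (if ∃ κ, ∀ m, E m - E (-m) = κ * m then 1 else 0)) := by
  have h2 : (2 : ZMod p) ≠ 0 := by
    have := ZMod.prime_ne_zero p 2 hp
    exact_mod_cast this
  set L := annihilator (commSpan E (sumZero p)) with hL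
  have hsd : ∀ l ∈ L, shiftDiff p l ∈ L := fun l hl => shiftDiff_mem_annihilator hl
  have himp : (∃ u κ, ∀ m, m ≠ 0 → E m = u + κ * m) → ∃ κ, ∀ m, E m - E (-m) = κ * m := by
    rintro ⟨u, κ, h⟩
    refine ⟨2 * κ, fun m => ?_⟩
    by_cases hm : m = 0
    · simp [hm]
    · rw [h m hm, h _ (neg_ne_zero.mpr hm)]
      ring
  have hne : (fun _ => 1 : ZMod p → ZMod p) ≠ 0 := fun h => one_ne_zero (congrFun h 0)
  have h1L : ∀ l ∈ L, l ≠ 0 → (fun _ => 1 : ZMod p → ZMod p) ∈ L := by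
    intro l hl hl0
    obtain ⟨m, hm, hm1, hm2⟩ := exists_shiftDiff_pow L hsd hl 0 (by simpa)
    have hc := eq_const_of_shiftDiff (l := m) (by simpa using hm2)
    have hm0 : m 0 ≠ 0 := fun h => hm1 (by
      funext k
      simpa [h] using hc k)
    have : (fun _ => 1 : ZMod p → ZMod p) = (m 0)⁻¹ • m := by
      funext k
      simp [hc k, hm0]
    rw [this]
    exact L.smul_mem _ hm
  have hidL : ∀ l ∈ L, shiftDiff p l ≠ 0 → (fun k => k : ZMod p → ZMod p) ∈ L := by
    intro l hl hl0
    have h1 := h1L _ (hsd l hl) hl0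
    obtain ⟨m, hm, hm1, hm2⟩ := exists_shiftDiff_pow L hsd hl 1 (by simpa)
    have hc := eq_affine_of_shiftDiff hm2
    have hm0 : shiftDiff p m 0 ≠ 0 := fun h => hm1 (by
      funext k
      have := eq_const_of_shiftDiff (l := shiftDiff p m) (by rwa [pow_two] at hm2) k
      simpa [h] using this)
    have : (fun k => k : ZMod p → ZMod p) =
        (shiftDiff p m 0)⁻¹ • (m - m 0 • (fun _ => 1 : ZMod p → ZMod p)) := by
      funext k
      have e := hc k
      simp only [Pi.smul_apply, Pi.sub_apply, smul_eq_mul, mul_one]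
      rw [e]
      field_simp
      ring
    rw [this]
    exact L.smul_mem _ (L.sub_mem hm (L.smul_mem _ h1))
  rw [index_eq_of_annihilator, ← hL]
  congr 1
  by_cases hs : ∃ κ, ∀ m, E m - E (-m) = κ * m
  · rw [if_pos hs]
    have h1 := (one_mem_annihilator_iff).mpr hs
    by_cases hc : ∃ u κ, ∀ m, m ≠ 0 → E m = u + κ * m
    · rw [if_pos hc]
      have hid := (id_mem_annihilator_iff hp h0 h1).mpr hc
      have hli : LinearIndependent (ZMod p)
          ![(fun _ => 1 : ZMod p → ZMod p), (fun k => k : ZMod p → ZMod p)] := by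
        rw [LinearIndependent.pair_iff]
        intro s t hst
        have e0 := congrFun hst 0
        have e1 := congrFun hst 1
        simp only [Pi.add_apply, Pi.smul_apply, smul_eq_mul, mul_one, mul_zero, add_zero,
          Pi.zero_apply] at e0 e1
        exact ⟨e0, by simpa [e0] using e1⟩
      have : L = Submodule.span (ZMod p) (Set.range
          ![(fun _ => 1 : ZMod p → ZMod p), (fun k => k : ZMod p → ZMod p)]) := by
        apply le_antisymm
        · intro l hl
          have hq : (shiftDiff p ^ 2) l = 0 := by
            by_contra hq
            obtain ⟨m, hm, hm1, hm2⟩ := exists_shiftDiff_pow L hsd hl 2 hq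
            have hquad := eq_quadratic_of_shiftDiff hp hm2
            have hd : shiftDiff p (shiftDiff p m) 0 ≠ 0 := fun h => hm1 (by
              funext k
              have := eq_const_of_shiftDiff (l := shiftDiff p (shiftDiff p m))
                (by rwa [pow_succ', pow_two] at hm2) k
              rw [h] at this
              exact this)
            set d := shiftDiff p (shiftDiff p m) 0
            set b := shiftDiff p m 0
            obtain ⟨u, κ, hκ⟩ := hc
            have hκ0 : κ ≠ 0 := by
              rintro rfl
              exact hE ⟨u, fun m hm => by simpa using hκ m hm⟩
            refine sq_notMem_annihilator hp hκ0 hκ ?_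
            have : (fun k => k ^ 2 : ZMod p → ZMod p) = (d / 2)⁻¹ •
                (m - m 0 • (fun _ => 1 : ZMod p → ZMod p)
                  - (b - d / 2) • (fun k => k : ZMod p → ZMod p)) := by
              funext k
              have e := hquad k
              simp only [Pi.smul_apply, Pi.sub_apply, smul_eq_mul, mul_one]
              rw [e]
              field_simp
              ring
            rw [this]
            exact L.smul_mem _ (L.sub_mem (L.sub_mem hm (L.smul_mem _ h1)) (L.smul_mem _ hid))
          have haff := eq_affine_of_shiftDiff hq
          rw [Submodule.mem_span_range_iff_exists_fun]
          refine ⟨![l 0, shiftDiff p l 0], ?_⟩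
          funext k
          simp [Fin.sum_univ_two, haff k]
        · rw [Submodule.span_le]
          rintro _ ⟨i, rfl⟩
          fin_cases i
          · exact h1
          · exact hid
      rw [this, finrank_span_eq_card hli]
      simp
    · rw [if_neg hc]
      have : L = Submodule.span (ZMod p) {fun _ => (1 : ZMod p)} := by
        apply le_antisymm
        · intro l hl
          have hq : shiftDiff p l = 0 := by
            by_contra hq
            exact hc ((id_mem_annihilator_iff hp h0 h1).mp (hidL l hl hq))
          rw [Submodule.mem_span_singleton]
          refine ⟨l 0, funext fun k => ?_⟩
          simp [eq_const_of_shiftDiff hq k]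
        · rw [Submodule.span_le]
          rintro _ rfl
          exact h1
      rw [this, finrank_span_singleton hne]
  · rw [if_neg hs, if_neg (mt himp hs), show L = ⊥ from ?_, finrank_bot]
    rw [Submodule.eq_bot_iff]
    intro l hl
    by_contra hne
    exact hs ((one_mem_annihilator_iff).mp (h1L l hl hne))

end SumZero

end LinearAlgebra

/-! ### Power moments of functions on `ZMod p`. -/

section Moments

variable {p : ℕ} [Fact p.Prime]

/-- The power moments of a function on `ZMod p`. -/
def moment (n : ℕ) (v : ZMod p → ZMod p) : ZMod p := ∑ k, k ^ n * v k

theorem moment_add (n : ℕ) (v w : ZMod p → ZMod p) :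
    moment n (fun k => v k + w k) = moment n v + moment n w := by
  simp [moment, mul_add, sum_add_distrib]

theorem moment_shift (n : ℕ) (v : ZMod p → ZMod p) (c : ZMod p) :
    moment n (fun k => v (k + c)) =
      ∑ m ∈ range (n + 1), (-c) ^ (n - m) * (n.choose m : ZMod p) * moment m v := by
  unfold moment
  rw [← Equiv.sum_comp (Equiv.subRight c)]
  simp only [Equiv.subRight_apply, sub_add_cancel, mul_sum]
  rw [sum_comm]
  refine sum_congr rfl fun k _ => ?_
  rw [sub_eq_add_neg, add_pow, sum_mul]
  refine sum_congr rfl fun m _ => ?_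
  ring

/-- By the binomial expansion a shift changes a moment only by multiples of lower moments. -/
theorem moment_shift_of_vanish {n : ℕ} {v : ZMod p → ZMod p} (h : ∀ m < n, moment m v = 0)
    (c : ZMod p) : moment n (fun k => v (k + c)) = moment n v := by
  rw [moment_shift, sum_range_succ, sum_eq_zero]
  · simp
  · intro m hm
    rw [h m (mem_range.mp hm), mul_zero]

theorem moment_succ_shift_of_vanish {n : ℕ} {v : ZMod p → ZMod p} (h : ∀ m < n, moment m v = 0)
    (c : ZMod p) :
    moment (n + 1) (fun k => v (k + c)) = moment (n + 1) v - (n + 1) * c * moment n v := by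
  rw [moment_shift, sum_range_succ, sum_range_succ, sum_eq_zero]
  · simp
    ring
  · intro m hm
    rw [h m (mem_range.mp hm), mul_zero]

/-- By Fermat the (p-1)-st moment is the total sum minus the value at 0. It is shift-invariant
because the lower moments vanish, so all values agree. -/
theorem eq_of_moments_eq_zero {v : ZMod p → ZMod p} (h : ∀ n, n + 1 < p → moment n v = 0)
    (j : ZMod p) : v j = v 0 := by
  have hp : 2 ≤ p := (Fact.out : p.Prime).two_le
  have key : ∀ j, v j = ∑ k, v k - moment (p - 1) v := by
    intro j
    have h1 : moment (p - 1) (fun k => v (k + j)) = moment (p - 1) v :=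
      moment_shift_of_vanish (fun m hm => h m (by omega)) j
    rw [← h1]
    have h2 : moment (p - 1) (fun k => v (k + j)) = ∑ k, v (k + j) - v j := by
      unfold moment
      rw [← sum_erase_add _ _ (mem_univ (0 : ZMod p)),
        ← sum_erase_add (f := fun k => v (k + j)) _ (mem_univ (0 : ZMod p)), zero_pow (by omega),
        zero_mul, add_zero, zero_add, add_sub_cancel_right]
      refine sum_congr rfl fun k hk => ?_
      rw [ZMod.pow_card_sub_one_eq_one (ne_of_mem_erase hk), one_mul]
    have h3 : ∑ k, v (k + j) = ∑ k, v k := Equiv.sum_comp (Equiv.addRight j) v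
    rw [h2, h3]
    ring
  rw [key j, key 0]

end Moments

/-! ### Abstract wreath recursions and cocycles. -/

/-- A group `Γ` generated by two elements `a`, `b` of order dividing `p` and acting faithfully on the
`p`-regular rooted tree: every `g` shifts the first letter by `root g` and then acts below the
letter `k` as `sec g k`. Here `a` is the rooted shift and `b` fixes the first level, with sections
`b` at `0` and `a ^ E k` at `k ≠ 0`. -/
structure WreathRecursion (p : ℕ) (E : ZMod p → ZMod p) (Γ : Type*) [Group Γ] where
  a : Γ
  b : Γ
  root : Γ → ZMod p
  sec : Γ → ZMod p → Γ
  root_mul : ∀ g h, root (g * h) = root g + root h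
  sec_mul : ∀ g h k, sec (g * h) k = sec g (k + root h) * sec h k
  faithful : ∀ g, root g = 0 → (∀ k, sec g k = 1) → g = 1
  root_a : root a = 1
  sec_a : ∀ k, sec a k = 1
  root_b : root b = 0
  sec_b_zero : sec b 0 = b
  sec_b : ∀ k, k ≠ 0 → sec b k = a ^ (E k).val
  closure_eq : Subgroup.closure {a, b} = ⊤
  a_pow : a ^ p = 1
  b_pow : b ^ p = 1

namespace WreathRecursion

variable {p : ℕ} {E : ZMod p → ZMod p} {Γ : Type*} [Group Γ]
  (D : WreathRecursion p E Γ)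

theorem root_one : D.root 1 = 0 := by
  have := D.root_mul 1 1
  rw [mul_one] at this
  exact left_eq_add.mp this

theorem root_inv (g : Γ) : D.root g⁻¹ = -D.root g := by
  have := D.root_mul g⁻¹ g
  rw [inv_mul_cancel, root_one] at this
  exact eq_neg_of_add_eq_zero_left this.symm

theorem root_pow (g : Γ) (n : ℕ) : D.root (g ^ n) = n * D.root g := by
  induction n with
  | zero => simp [root_one]
  | succ n ih => rw [pow_succ, D.root_mul, ih]; push_cast; ring

theorem sec_one (k : ZMod p) : D.sec 1 k = 1 := by
  have := D.sec_mul 1 1 k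
  rw [mul_one, root_one, add_zero] at this
  exact left_eq_mul.mp this

theorem sec_inv (g : Γ) (k : ZMod p) : D.sec g⁻¹ k = (D.sec g (k - D.root g))⁻¹ := by
  have := D.sec_mul g g⁻¹ k
  rw [mul_inv_cancel, sec_one, root_inv, ← sub_eq_add_neg] at this
  exact (inv_eq_of_mul_eq_one_right this.symm).symm

theorem sec_a_pow (n : ℕ) (k : ZMod p) : D.sec (D.a ^ n) k = 1 := by
  induction n with
  | zero => simp [sec_one]
  | succ n ih => rw [pow_succ', D.sec_mul, D.sec_a, ih, one_mul]

theorem sec_pow {g : Γ} (hg : D.root g = 0) (n : ℕ) (k : ZMod p) :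
    D.sec (g ^ n) k = D.sec g k ^ n := by
  induction n with
  | zero => simp [sec_one]
  | succ n ih => rw [pow_succ, D.sec_mul, hg, add_zero, ih, pow_succ]

theorem ext_of_sec {g h : Γ} (hr : D.root g = D.root h) (hs : ∀ k, D.sec g k = D.sec h k) :
    g = h := by
  rw [← mul_inv_eq_one]
  refine D.faithful _ (by rw [D.root_mul, root_inv, hr, add_neg_cancel]) fun k => ?_
  rw [D.sec_mul, D.sec_inv, D.root_inv, hs, ← sub_eq_add_neg, mul_inv_cancel]

/-- The stabilizer of the first level. -/
def stab : Subgroup Γ where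
  carrier := {g | D.root g = 0}
  mul_mem' := by
    intro g h hg hh
    simp only [Set.mem_ofPred_eq] at *
    rw [D.root_mul, hg, hh, add_zero]
  one_mem' := D.root_one
  inv_mem' := by
    intro g hg
    simp only [Set.mem_ofPred_eq] at *
    rw [D.root_inv, hg, neg_zero]

theorem mem_stab {g : Γ} : g ∈ D.stab ↔ D.root g = 0 := Iff.rfl

instance stab_normal : D.stab.Normal where
  conj_mem := by
    intro n hn g
    rw [mem_stab] at *
    rw [D.root_mul, D.root_mul, D.root_inv, hn]
    ring

theorem commutator_le_stab : commutator Γ ≤ D.stab := by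
  rw [commutator_def, Subgroup.commutator_le]
  intro g _ h _
  rw [mem_stab, commutatorElement_def]
  simp only [D.root_mul, D.root_inv]
  ring

theorem sec_conj {g : Γ} (hg : D.root g = 0) (t : Γ) (k : ZMod p) :
    D.sec (t * g * t⁻¹) k =
      D.sec t (k - D.root t) * D.sec g (k - D.root t) * (D.sec t (k - D.root t))⁻¹ := by
  rw [D.sec_mul, D.sec_mul, D.sec_inv, D.root_inv, hg, add_zero, ← sub_eq_add_neg]

theorem sec_commutatorElement {g h : Γ} (hg : D.root g = 0) (hh : D.root h = 0) (k : ZMod p) :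
    D.sec ⁅g, h⁆ k = ⁅D.sec g k, D.sec h k⁆ := by
  simp only [commutatorElement_def, D.sec_mul, D.sec_inv, D.root_inv, hg, hh, neg_zero, add_zero,
    sub_zero]

/-- The power `a ^ t` for a residue `t`. -/
def aPow (t : ZMod p) : Γ := D.a ^ t.val

/-- The conjugate of `b` whose section `b` sits at `i`. -/
def bConj (i : ZMod p) : Γ := D.aPow i * D.b * (D.aPow i)⁻¹

/-- A map to functions on the first level is a cocycle if it is compatible with the wreath
recursion. -/
def IsCocycle (f : Γ → ZMod p → ZMod p) : Prop :=
  ∀ g h k, f (g * h) k = f g (k + D.root h) + f h k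

/-- The root permutations of the first-level sections. -/
def vec (g : Γ) (k : ZMod p) : ZMod p := D.root (D.sec g k)

variable {D}

theorem IsCocycle.map_one {f : Γ → ZMod p → ZMod p} (hf : D.IsCocycle f) (k : ZMod p) :
    f 1 k = 0 := by
  have := hf 1 1 k
  rw [mul_one, D.root_one, add_zero] at this
  exact left_eq_add.mp this

/-- A product adds a shifted value to a value, so a shift-invariant subgroup has to be tested only
on `a` and `b`. -/
theorem IsCocycle.mem {f : Γ → ZMod p → ZMod p} (hf : D.IsCocycle f)
    {L : AddSubgroup (ZMod p → ZMod p)} (hL : ∀ v ∈ L, ∀ c, (fun k => v (k + c)) ∈ L)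
    (ha : f D.a ∈ L) (hb : f D.b ∈ L) (g : Γ) : f g ∈ L := by
  have hg : g ∈ Subgroup.closure {D.a, D.b} := by rw [D.closure_eq]; trivial
  induction hg using Subgroup.closure_induction with
  | mem x hx =>
    rcases hx with rfl | rfl
    · exact ha
    · exact hb
  | one =>
    have : f 1 = 0 := funext hf.map_one
    rw [this]
    exact L.zero_mem
  | mul x y _ _ hx hy =>
    have : f (x * y) = (fun k => f x (k + D.root y)) + f y := funext fun k => hf x y k
    rw [this]
    exact L.add_mem (hL _ hx _) hy
  | inv x _ hx =>
    have : f x⁻¹ = -(fun k => f x (k + (-D.root x))) := by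
      funext k
      have := hf x x⁻¹ k
      rw [mul_inv_cancel, hf.map_one, D.root_inv] at this
      exact eq_neg_of_add_eq_zero_right this.symm
    rw [this]
    exact L.neg_mem (hL _ hx _)

theorem IsCocycle.eq {f f' : Γ → ZMod p → ZMod p} (hf : D.IsCocycle f) (hf' : D.IsCocycle f')
    (ha : f D.a = f' D.a) (hb : f D.b = f' D.b) (g : Γ) : f g = f' g := by
  have h : D.IsCocycle (fun g => f g - f' g) := by
    intro g h k
    simp only [Pi.sub_apply]
    rw [hf, hf']
    ring
  have := h.mem (L := ⊥) (by
    intro v hv c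
    rw [AddSubgroup.mem_bot] at hv
    subst hv
    rfl) (by simp [ha]) (by simp [hb]) g
  rw [AddSubgroup.mem_bot] at this
  exact sub_eq_zero.mp this

variable (D)

theorem isCocycle_vec : D.IsCocycle D.vec := by
  intro g h k
  unfold vec
  rw [D.sec_mul, D.root_mul]

theorem vec_a : D.vec D.a = 0 := by
  funext k
  simp [vec, D.sec_a, D.root_one]

theorem sec_aPow (t k : ZMod p) : D.sec (D.aPow t) k = 1 := D.sec_a_pow _ _

theorem bConj_pow_prime (i : ZMod p) : D.bConj i ^ p = 1 := by
  rw [bConj, conj_pow, D.b_pow]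
  simp

section Prime

variable [Fact p.Prime]

theorem root_aPow (t : ZMod p) : D.root (D.aPow t) = t := by
  rw [aPow, D.root_pow, D.root_a, mul_one, ZMod.natCast_zmod_val]

theorem aPow_zero : D.aPow 0 = 1 := by simp [aPow]

theorem aPow_one : D.aPow 1 = D.a := by
  have : Fact (1 < p) := ⟨(Fact.out : p.Prime).one_lt⟩
  rw [aPow, ZMod.val_one, pow_one]

theorem aPow_add (s t : ZMod p) : D.aPow (s + t) = D.aPow s * D.aPow t :=
  D.ext_of_sec (by simp only [D.root_mul, root_aPow])
    (fun k => by simp only [D.sec_mul, sec_aPow, one_mul])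

theorem aPow_neg (t : ZMod p) : D.aPow (-t) = (D.aPow t)⁻¹ := by
  rw [eq_inv_iff_mul_eq_one, ← aPow_add, neg_add_cancel, aPow_zero]

theorem aPow_pow (t : ZMod p) (n : ℕ) : D.aPow t ^ n = D.aPow (n * t) := by
  induction n with
  | zero => simp [aPow_zero]
  | succ n ih => rw [pow_succ, ih, ← aPow_add]; congr 1; push_cast; ring

theorem aPow_comm (s t : ZMod p) : D.aPow s * D.aPow t = D.aPow t * D.aPow s := by
  rw [← aPow_add, ← aPow_add, add_comm]

theorem root_bConj (i : ZMod p) : D.root (D.bConj i) = 0 := by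
  rw [bConj, D.root_mul, D.root_mul, D.root_inv, D.root_b]
  ring

theorem sec_bConj (i k : ZMod p) : D.sec (D.bConj i) k = D.sec D.b (k - i) := by
  rw [bConj, D.sec_conj D.root_b, root_aPow, sec_aPow]
  simp

theorem sec_bConj_self (i : ZMod p) : D.sec (D.bConj i) i = D.b := by
  rw [sec_bConj, sub_self, D.sec_b_zero]

theorem sec_bConj_of_ne {i k : ZMod p} (h : k ≠ i) :
    D.sec (D.bConj i) k = D.aPow (E (k - i)) := by
  rw [sec_bConj, D.sec_b _ (sub_ne_zero.mpr h), aPow]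

theorem vec_b (h0 : E 0 = 0) : D.vec D.b = E := by
  funext k
  unfold vec
  by_cases h : k = 0
  · rw [h, D.sec_b_zero, D.root_b, h0]
  · rw [D.sec_b k h, D.root_pow, D.root_a, mul_one, ZMod.natCast_zmod_val]

end Prime

/-! ### The Heisenberg quotient and its kernel. -/

/-- Coordinates `ε`, `η` that, together with `root`, describe the largest quotient of class two:
`(root, ε, η)` is a homomorphism to a Heisenberg group over `ZMod p`. -/
structure Heisenberg where
  ε : Γ → ZMod p
  η : Γ → ZMod p
  ε_mul : ∀ g h, ε (g * h) = ε g + ε h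
  η_mul : ∀ g h, η (g * h) = η g + η h - D.root h * ε g
  ε_a : ε D.a = 0
  ε_b : ε D.b = 1
  η_a : η D.a = 0
  η_b : η D.b = 0

/-- Let r be the first order at which `E` has a nonzero moment. All moments of `vec g` below r
vanish, so the r-th moment is shift-invariant and hence additive in g. The next moment picks up,
under a shift, a multiple of the r-th: this is the Heisenberg cocycle. Normalizing gives `ε` and
`η`. -/
theorem nonempty_heisenberg [Fact p.Prime] (h0 : E 0 = 0)
    (hE : ¬ ∃ u, ∀ m, m ≠ 0 → E m = u) : Nonempty D.Heisenberg := by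
  classical
  have hex : ∃ n, n + 1 < p ∧ moment n E ≠ 0 := by
    by_contra! h
    refine hE ⟨0, fun m _ => ?_⟩
    rw [eq_of_moments_eq_zero h m, h0]
  obtain ⟨hr, hM⟩ := Nat.find_spec hex
  set r := Nat.find hex
  have hmin : ∀ m < r, moment m E = 0 := by
    intro m hm
    by_contra h
    exact Nat.find_min hex hm ⟨by omega, h⟩
  -- The bound r + 1 < p makes the coefficient of the cocycle invertible.
  have hr1 : ((r : ZMod p) + 1) ≠ 0 := by
    intro h
    have : ((r + 1 : ℕ) : ZMod p) = 0 := by exact_mod_cast h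
    rw [ZMod.natCast_eq_zero_iff] at this
    exact absurd (Nat.le_of_dvd (by omega) this) (by omega)
  let L : AddSubgroup (ZMod p → ZMod p) :=
    { carrier := {v | ∀ m < r, moment m v = 0}
      add_mem' := by
        intro v w hv hw m hm
        have := moment_add m v w
        rw [hv m hm, hw m hm, add_zero] at this
        exact this
      zero_mem' := by
        intro m _
        simp [moment]
      neg_mem' := by
        intro v hv m hm
        have := hv m hm
        simp only [moment, Pi.neg_apply, mul_neg, sum_neg_distrib, neg_eq_zero] at *
        exact this }
  have hvan : ∀ g, ∀ m < r, moment m (D.vec g) = 0 := by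
    intro g
    refine D.isCocycle_vec.mem (L := L) ?_ ?_ ?_ g
    · intro v hv c m hm
      rw [moment_shift_of_vanish (fun n hn => hv n (hn.trans hm)), hv m hm]
    · rw [D.vec_a]
      exact L.zero_mem
    · rw [D.vec_b h0]
      exact hmin
  have hmul : ∀ n g h, moment n (D.vec (g * h)) =
      moment n (fun k => D.vec g (k + D.root h)) + moment n (D.vec h) := by
    intro n g h
    rw [← moment_add]
    congr 1
    exact funext (D.isCocycle_vec g h)
  have hz : ∀ n, moment n (0 : ZMod p → ZMod p) = 0 := fun n => by simp [moment]
  -- Subtracting `c` times the homomorphism `ε` arranges `η b = 0` and keeps the multiplication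
  -- rule.
  set c := moment (r + 1) E / ((r + 1) * moment r E)
  refine ⟨⟨fun g => moment r (D.vec g) / moment r E,
    fun g => moment (r + 1) (D.vec g) / ((r + 1) * moment r E) - c * (moment r (D.vec g) / moment r E),
    ?_, ?_, ?_, ?_, ?_, ?_⟩⟩
  · intro g h
    rw [hmul, moment_shift_of_vanish (hvan g), add_div]
  · intro g h
    rw [hmul, hmul, moment_shift_of_vanish (hvan g), moment_succ_shift_of_vanish (hvan g)]
    field_simp
    ring
  · rw [D.vec_a, hz, zero_div]
  · rw [D.vec_b h0, div_self hM]
  · rw [D.vec_a, hz, hz]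
    simp
  · rw [D.vec_b h0, div_self hM]
    simp [c]

end WreathRecursion

/-- A group generated by two elements whose commutator is central consists of the products
`a ^ i * b ^ j * ⁅a, b⁆ ^ k`. -/
theorem exists_eq_zpow_mul_zpow_mul_zpow {Q : Type*} [Group Q] {a b : Q}
    (hgen : Subgroup.closure {a, b} = ⊤) (ha : Commute ⁅a, b⁆ a) (hb : Commute ⁅a, b⁆ b) (q : Q) :
    ∃ i j k : ℤ, q = a ^ i * b ^ j * ⁅a, b⁆ ^ k := by
  set c := ⁅a, b⁆ with hc
  have h1 : ∀ i : ℤ, b * a ^ i * b⁻¹ = c ^ (-i) * a ^ i := by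
    intro i
    rw [← conj_zpow, zpow_neg, ← inv_zpow, ← ha.inv_left.mul_zpow]
    congr 1
    rw [hc, commutatorElement_inv, commutatorElement_def]
    group
  have h2 : ∀ i : ℤ, a ^ (-i) * b * a ^ i = c ^ (-i) * b := by
    intro i
    have := h1 i
    have hcomm : Commute (c ^ (-i)) (a ^ (-i)) := (ha.zpow_zpow _ _)
    calc a ^ (-i) * b * a ^ i = a ^ (-i) * (b * a ^ i * b⁻¹) * b := by group
      _ = a ^ (-i) * c ^ (-i) * a ^ i * b := by rw [this]; group
      _ = c ^ (-i) * b := by rw [← hcomm.eq]; group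
  have h3 : ∀ i j : ℤ, b ^ j * a ^ i = a ^ i * (b ^ j * c ^ (-i * j)) := by
    intro i j
    have e : (a ^ (-i) * b * a ^ i) ^ j = a ^ (-i) * b ^ j * a ^ i := by
      have := conj_zpow (i := j) (a := a ^ (-i)) (b := b)
      rw [zpow_neg, inv_inv] at this
      rw [zpow_neg, this]
    rw [h2, (hb.zpow_left _).mul_zpow, ← zpow_mul] at e
    rw [(hb.zpow_zpow (-i * j) j).eq.symm, e]
    group
  have hq : q ∈ Subgroup.closure {a, b} := by rw [hgen]; trivial
  induction hq using Subgroup.closure_induction with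
  | mem x hx =>
    rcases hx with rfl | rfl
    · exact ⟨1, 0, 0, by simp⟩
    · exact ⟨0, 1, 0, by simp⟩
  | one => exact ⟨0, 0, 0, by simp⟩
  | mul x y _ _ hx hy =>
    obtain ⟨i, j, k, rfl⟩ := hx
    obtain ⟨i', j', k', rfl⟩ := hy
    refine ⟨i + i', j + j', k + k' + -i' * j, ?_⟩
    calc a ^ i * b ^ j * c ^ k * (a ^ i' * b ^ j' * c ^ k')
        = a ^ i * b ^ j * (c ^ k * a ^ i') * b ^ j' * c ^ k' := by group
      _ = a ^ i * (b ^ j * a ^ i') * (c ^ k * b ^ j') * c ^ k' := by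
          rw [(ha.zpow_zpow k i').eq]; group
      _ = a ^ i * a ^ i' * b ^ j * (c ^ (-i' * j) * b ^ j') * c ^ k * c ^ k' := by
          rw [h3, (hb.zpow_zpow k j').eq]; group
      _ = _ := by
          rw [(hb.zpow_zpow _ j').eq, zpow_add a, zpow_add b, zpow_add c, zpow_add c]
          have : c ^ k * c ^ k' * c ^ (-i' * j) = c ^ (-i' * j) * c ^ k * c ^ k' := by
            simp only [← zpow_add]; congr 1; ring
          rw [this]
          group
  | inv x _ hx =>
    obtain ⟨i, j, k, rfl⟩ := hx
    refine ⟨-i, -j, -k + -i * j, ?_⟩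
    calc (a ^ i * b ^ j * c ^ k)⁻¹ = c ^ (-k) * (b ^ (-j) * a ^ (-i)) := by group
      _ = c ^ (-k) * a ^ (-i) * b ^ (-j) * c ^ (-(-i) * -j) := by rw [h3]; group
      _ = a ^ (-i) * (c ^ (-k) * b ^ (-j)) * c ^ (-(-i) * -j) := by
          rw [(ha.zpow_zpow (-k) (-i)).eq]; group
      _ = _ := by
          rw [(hb.zpow_zpow (-k) (-j)).eq, zpow_add]
          have : -(-i) * -j = -i * j := by ring
          rw [this]
          group

/-- `⁅a, b⁆ * b` is conjugate to `b`, so its p-th power is trivial; that power also splits as a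
product. -/
theorem commutatorElement_pow_eq_one {Q : Type*} [Group Q] {a b : Q} {p : ℕ} (hp : b ^ p = 1)
    (hb : Commute ⁅a, b⁆ b) : ⁅a, b⁆ ^ p = 1 := by
  have h : ⁅a, b⁆ * b = a * b * a⁻¹ := by rw [commutatorElement_def]; group
  have h2 := hb.mul_pow p
  rw [h, conj_pow, hp] at h2
  simpa using h2.symm

theorem zpow_of_mul_eq_add {Γ A : Type*} [Group Γ] [Ring A] {f : Γ → A}
    (hf : ∀ g h, f (g * h) = f g + f h) (g : Γ) (n : ℤ) : f (g ^ n) = n * f g := by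
  let F : Γ →* Multiplicative A := MonoidHom.mk' (fun g => Multiplicative.ofAdd (f g))
    (fun g h => by rw [hf, ofAdd_add])
  have := congrArg Multiplicative.toAdd (map_zpow F g n)
  simpa [F] using this

namespace WreathRecursion

variable {p : ℕ} {E : ZMod p → ZMod p} {Γ : Type*} [Group Γ]
  {D : WreathRecursion p E Γ}

theorem zpow_eq_one_of_pow {Q : Type*} [Group Q] {x : Q} (hx : x ^ p = 1) {n : ℤ}
    (hn : (n : ZMod p) = 0) : x ^ n = 1 := by
  obtain ⟨m, rfl⟩ := (ZMod.intCast_zmod_eq_zero_iff_dvd n p).mp hn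
  rw [zpow_mul, zpow_natCast, hx, one_zpow]

variable (D) in
theorem a_zpow_eq_one {n : ℤ} (hn : (n : ZMod p) = 0) : D.a ^ n = 1 :=
  zpow_eq_one_of_pow D.a_pow hn

variable (D) in
theorem b_zpow_eq_one {n : ℤ} (hn : (n : ZMod p) = 0) : D.b ^ n = 1 :=
  zpow_eq_one_of_pow D.b_pow hn

namespace Heisenberg

variable (H : D.Heisenberg)

theorem ε_one : H.ε 1 = 0 := by
  have := H.ε_mul 1 1
  rw [mul_one] at this
  exact left_eq_add.mp this

theorem ε_inv (g : Γ) : H.ε g⁻¹ = -H.ε g := by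
  have := H.ε_mul g⁻¹ g
  rw [inv_mul_cancel, ε_one] at this
  exact eq_neg_of_add_eq_zero_left this.symm

theorem ε_pow (g : Γ) (n : ℕ) : H.ε (g ^ n) = n * H.ε g := by
  induction n with
  | zero => simp [ε_one]
  | succ n ih => rw [pow_succ, H.ε_mul, ih]; push_cast; ring

theorem ε_aPow (t : ZMod p) : H.ε (D.aPow t) = 0 := by
  rw [aPow, H.ε_pow, H.ε_a, mul_zero]

theorem η_one : H.η 1 = 0 := by
  have := H.η_mul 1 1
  rw [mul_one, H.ε_one, mul_zero, sub_zero] at this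
  exact left_eq_add.mp this

theorem η_mul_of_ε {g : Γ} (hg : H.ε g = 0) (h : Γ) : H.η (g * h) = H.η g + H.η h := by
  rw [H.η_mul, hg, mul_zero, sub_zero]

theorem η_inv {g : Γ} (hg : H.ε g = 0) : H.η g⁻¹ = -H.η g := by
  have := H.η_mul_of_ε hg g⁻¹
  rw [mul_inv_cancel, η_one] at this
  exact eq_neg_of_add_eq_zero_right this.symm

theorem η_zpow {g : Γ} (hg : H.ε g = 0) (n : ℤ) : H.η (g ^ n) = n * H.η g := by
  have hn : ∀ n : ℕ, H.η (g ^ n) = n * H.η g := by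
    intro n
    induction n with
    | zero => simp [η_one]
    | succ n ih => rw [pow_succ', H.η_mul_of_ε hg, ih]; push_cast; ring
  cases n with
  | ofNat n => simpa using hn n
  | negSucc n =>
    rw [zpow_negSucc, H.η_inv (by rw [H.ε_pow, hg, mul_zero]), hn]
    push_cast
    ring

theorem ε_commutatorElement (g h : Γ) : H.ε ⁅g, h⁆ = 0 := by
  rw [commutatorElement_def]
  have h1 : ∀ g, H.ε g⁻¹ = -H.ε g := fun g => H.ε_inv g
  simp only [H.ε_mul, h1]
  ring

theorem η_commutatorElement (g h : Γ) :
    H.η ⁅g, h⁆ = D.root g * H.ε h - D.root h * H.ε g := by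
  have h1 := H.η_mul_of_ε (H.ε_commutatorElement g h) (h * g)
  have h2 : ⁅g, h⁆ * (h * g) = g * h := by rw [commutatorElement_def]; group
  rw [h2, H.η_mul, H.η_mul] at h1
  linear_combination -h1

/-- The elements with trivial image in the Heisenberg group. -/
def kernel : Subgroup Γ where
  carrier := {g | D.root g = 0 ∧ H.ε g = 0 ∧ H.η g = 0}
  mul_mem' := by
    rintro g h ⟨h1, h2, h3⟩ ⟨k1, k2, k3⟩
    refine ⟨by rw [D.root_mul, h1, k1, add_zero], by rw [H.ε_mul, h2, k2, add_zero], ?_⟩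
    rw [H.η_mul_of_ε h2, h3, k3, add_zero]
  one_mem' := ⟨D.root_one, H.ε_one, H.η_one⟩
  inv_mem' := by
    rintro g ⟨h1, h2, h3⟩
    exact ⟨by rw [D.root_inv, h1, neg_zero], by rw [H.ε_inv, h2, neg_zero],
      by rw [H.η_inv h2, h3, neg_zero]⟩

instance kernel_normal : H.kernel.Normal where
  conj_mem := by
    rintro n ⟨h1, h2, h3⟩ g
    have hr : D.root (g * n * g⁻¹) = 0 := by
      rw [D.root_mul, D.root_mul, D.root_inv, h1]; ring
    have he : H.ε (g * n * g⁻¹) = 0 := by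
      rw [H.ε_mul, H.ε_mul, H.ε_inv, h2]; ring
    refine ⟨hr, he, ?_⟩
    have e1 := H.η_mul_of_ε he g
    rw [inv_mul_cancel_right, H.η_mul, h1, h3] at e1
    linear_combination -e1

theorem commutatorElement_mem_kernel {g : Γ} (hr : D.root g = 0) (he : H.ε g = 0) (h : Γ) :
    ⁅g, h⁆ ∈ H.kernel := by
  refine ⟨?_, H.ε_commutatorElement g h, by rw [H.η_commutatorElement, hr, he]; ring⟩
  rw [commutatorElement_def]
  simp only [D.root_mul, D.root_inv]
  ring

theorem ε_of_mem_commutator {g : Γ} (hg : g ∈ commutator Γ) : H.ε g = 0 := by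
  let F : Γ →* Multiplicative (ZMod p) :=
    MonoidHom.mk' (fun g => Multiplicative.ofAdd (H.ε g)) (fun g h => by rw [H.ε_mul, ofAdd_add])
  have := Abelianization.commutator_subset_ker F hg
  exact Multiplicative.ofAdd.injective this

/-- Modulo `commutator Γ` every element is a^m b^n, with m and n relevant only mod p; `root` and `ε`
read off these exponents. -/
theorem mem_commutator_iff {g : Γ} : g ∈ commutator Γ ↔ D.root g = 0 ∧ H.ε g = 0 := by
  constructor
  · exact fun hg => ⟨D.commutator_le_stab hg, H.ε_of_mem_commutator hg⟩
  · rintro ⟨hr, he⟩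
    have hcl : Subgroup.closure {Abelianization.of D.a, Abelianization.of D.b} = ⊤ := by
      have := (Abelianization.of (G := Γ)).map_closure {D.a, D.b}
      rw [D.closure_eq, Set.image_pair] at this
      rw [← this, ← MonoidHom.range_eq_map, MonoidHom.range_eq_top]
      exact QuotientGroup.mk'_surjective _
    have hg : Abelianization.of g ∈
        Subgroup.closure {Abelianization.of D.a, Abelianization.of D.b} := by
      rw [hcl]; trivial
    rw [Subgroup.mem_closure_pair] at hg
    obtain ⟨m, n, hmn⟩ := hg
    rw [← map_zpow, ← map_zpow, ← map_mul] at hmn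
    have hmem : (D.a ^ m * D.b ^ n)⁻¹ * g ∈ commutator Γ := QuotientGroup.eq.mp hmn
    have hm := D.commutator_le_stab hmem
    have hn := H.ε_of_mem_commutator hmem
    rw [D.mem_stab, D.root_mul, D.root_inv, D.root_mul, zpow_of_mul_eq_add D.root_mul,
      zpow_of_mul_eq_add D.root_mul, D.root_a, D.root_b, hr] at hm
    rw [H.ε_mul, H.ε_inv, H.ε_mul, zpow_of_mul_eq_add H.ε_mul,
      zpow_of_mul_eq_add H.ε_mul, H.ε_a, H.ε_b, he] at hn
    rw [D.a_zpow_eq_one (by simpa using hm), D.b_zpow_eq_one (by simpa using hn)] at hmem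
    simpa using hmem

/-- The kernel of the map to the Heisenberg group is the smallest normal subgroup with a quotient of
class two. -/
theorem kernel_le {R : Subgroup Γ} [R.Normal] (ha : ⁅⁅D.a, D.b⁆, D.a⁆ ∈ R)
    (hb : ⁅⁅D.a, D.b⁆, D.b⁆ ∈ R) : H.kernel ≤ R := by
  have hcr : D.root ⁅D.a, D.b⁆ = 0 := by
    rw [commutatorElement_def]
    simp only [D.root_mul, D.root_inv]
    ring
  have hce := H.ε_commutatorElement D.a D.b
  have hcη : H.η ⁅D.a, D.b⁆ = 1 := by
    rw [H.η_commutatorElement, D.root_a, D.root_b, H.ε_b]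
    ring
  set c := ⁅D.a, D.b⁆ with hc
  set N := Subgroup.normalClosure {⁅c, D.a⁆, ⁅c, D.b⁆} with hN
  have hNR : N ≤ R := by
    refine Subgroup.normalClosure_le_normal ?_
    rintro _ (rfl | rfl)
    · exact ha
    · exact hb
  have hNT : N ≤ H.kernel := by
    refine Subgroup.normalClosure_le_normal ?_
    rintro _ (rfl | rfl)
    · exact H.commutatorElement_mem_kernel hcr hce _
    · exact H.commutatorElement_mem_kernel hcr hce _
  have hca : ⁅c, D.a⁆ ∈ N := Subgroup.subset_normalClosure (by simp)
  have hcb : ⁅c, D.b⁆ ∈ N := Subgroup.subset_normalClosure (by simp)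
  let q := QuotientGroup.mk' N
  have hq : ∀ {g}, q g = 1 ↔ g ∈ N := QuotientGroup.eq_one_iff _
  have hqc : ⁅q D.a, q D.b⁆ = q c := (map_commutatorElement q _ _).symm
  have hcl : Subgroup.closure {q D.a, q D.b} = ⊤ := by
    have := q.map_closure {D.a, D.b}
    rw [D.closure_eq, Set.image_pair] at this
    rw [← this, ← MonoidHom.range_eq_map, MonoidHom.range_eq_top]
    exact QuotientGroup.mk'_surjective _
  have hqa : Commute ⁅q D.a, q D.b⁆ (q D.a) := by
    rw [hqc, ← commutatorElement_eq_one_iff_commute, ← map_commutatorElement, hq]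
    exact hca
  have hqb : Commute ⁅q D.a, q D.b⁆ (q D.b) := by
    rw [hqc, ← commutatorElement_eq_one_iff_commute, ← map_commutatorElement, hq]
    exact hcb
  have hcp : q c ^ p = 1 := by
    rw [← hqc]
    exact commutatorElement_pow_eq_one (by rw [← map_pow, D.b_pow, map_one]) hqb
  intro g hg
  refine hNR ?_
  -- Modulo `N` the element is a^i b^j c^k. As `N ≤ H.kernel`, the coordinates `root`, `ε`, `η` of
  -- this normal form vanish, so i, j, k are 0 mod p.
  obtain ⟨i, j, k, hijk⟩ := exists_eq_zpow_mul_zpow_mul_zpow hcl hqa hqb (q g)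
  rw [hqc, ← map_zpow, ← map_zpow, ← map_zpow, ← map_mul, ← map_mul] at hijk
  have hmem : (D.a ^ i * D.b ^ j * c ^ k)⁻¹ * g ∈ N := QuotientGroup.eq.mp hijk.symm
  have hT : D.a ^ i * D.b ^ j * c ^ k ∈ H.kernel := by
    have := H.kernel.mul_mem hg (H.kernel.inv_mem (hNT hmem))
    simpa using this
  obtain ⟨h1, h2, h3⟩ := hT
  rw [D.root_mul, D.root_mul] at h1
  simp only [zpow_of_mul_eq_add D.root_mul, D.root_a, D.root_b, hcr] at h1
  rw [H.ε_mul, H.ε_mul] at h2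
  simp only [zpow_of_mul_eq_add H.ε_mul, H.ε_a, H.ε_b, hce] at h2
  rw [D.a_zpow_eq_one (by simpa using h1), D.b_zpow_eq_one (by simpa using h2), one_mul, one_mul,
    H.η_zpow hce, hcη, mul_one] at h3
  rw [← hq, hijk, D.a_zpow_eq_one (by simpa using h1), D.b_zpow_eq_one (by simpa using h2)]
  rw [one_mul, one_mul, map_zpow]
  exact zpow_eq_one_of_pow hcp h3

end Heisenberg
end WreathRecursion
-- The first-level stabilizer, its derived subgroup and the index formula.
namespace WreathRecursion

variable {p : ℕ} {E : ZMod p → ZMod p} {Γ : Type*} [Group Γ]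
  {D : WreathRecursion p E Γ}

namespace Heisenberg

variable (H : D.Heisenberg)

/-- The `ε`-coordinates of the first-level sections. -/
def xvec (g : Γ) (k : ZMod p) : ZMod p := H.ε (D.sec g k)

/-- The `η`-coordinates of the first-level sections. -/
def rho (g : Γ) (k : ZMod p) : ZMod p := H.η (D.sec g k)

theorem isCocycle_xvec : D.IsCocycle H.xvec := by
  intro g h k
  unfold xvec
  rw [D.sec_mul, H.ε_mul]

theorem xvec_a : H.xvec D.a = 0 := by
  funext k
  simp [xvec, D.sec_a, H.ε_one]

theorem xvec_mul {g h : Γ} (hh : D.root h = 0) : H.xvec (g * h) = H.xvec g + H.xvec h := by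
  funext k
  rw [H.isCocycle_xvec, hh, add_zero, Pi.add_apply]

variable [Fact p.Prime]

theorem xvec_b : H.xvec D.b = Pi.single 0 1 := by
  funext k
  unfold xvec
  by_cases h : k = 0
  · subst h
    rw [D.sec_b_zero, H.ε_b, Pi.single_eq_same]
  · rw [D.sec_b k h, H.ε_pow, H.ε_a, mul_zero, Pi.single_eq_of_ne h]

theorem xvec_bConj (i : ZMod p) : H.xvec (D.bConj i) = Pi.single i 1 := by
  funext k
  unfold xvec
  by_cases h : k = i
  · subst h
    rw [D.sec_bConj_self, H.ε_b, Pi.single_eq_same]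
  · rw [D.sec_bConj_of_ne h, H.ε_aPow, Pi.single_eq_of_ne h]

/-- Both sides are cocycles that agree on `a` and `b`. -/
theorem vec_eq_conv (h0 : E 0 = 0) (g : Γ) : D.vec g = conv E (H.xvec g) := by
  refine D.isCocycle_vec.eq (f' := fun g => conv E (H.xvec g)) ?_ ?_ ?_ g
  · intro g h k
    have : H.xvec (g * h) = (fun k => H.xvec g (k + D.root h)) + H.xvec h :=
      funext (H.isCocycle_xvec g h)
    simp only
    rw [this, conv_add, conv_shift]
  · rw [D.vec_a, H.xvec_a]
    funext k
    simp [conv]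
  · rw [D.vec_b h0, H.xvec_b]
    funext k
    rw [conv_single, sub_zero, one_mul]

theorem sum_xvec (g : Γ) : ∑ k, H.xvec g k = H.ε g := by
  have := IsCocycle.eq (D := D) (f := fun g _ => ∑ k, H.xvec g k) (f' := fun g _ => H.ε g)
    ?_ ?_ ?_ ?_ g
  · exact congrFun this 0
  · intro g h _
    have e : ∑ k, H.xvec g (k + D.root h) = ∑ k, H.xvec g k :=
      Equiv.sum_comp (Equiv.addRight (D.root h)) (H.xvec g)
    simp only
    rw [← e, ← sum_add_distrib]
    exact sum_congr rfl fun k _ => H.isCocycle_xvec g h k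
  · intro g h _
    exact H.ε_mul g h
  · simp [H.xvec_a, H.ε_a]
  · simp [H.xvec_b, H.ε_b]

/-- Products of powers of the conjugates of `b`, with sections at the unused positions. -/
theorem exists_prod_bConj (y : ZMod p → ZMod p) :
    ∃ d, D.root d = 0 ∧ H.xvec d = y ∧ ∀ k, y k = 0 → D.sec d k = D.aPow (conv E y k) := by
  classical
  have key : ∀ s : Finset (ZMod p), ∃ d, D.root d = 0 ∧
      H.xvec d = (fun k => if k ∈ s then y k else 0) ∧
      ∀ k, y k = 0 → D.sec d k = D.aPow (∑ i ∈ s, y i * E (k - i)) := by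
    intro s
    induction s using Finset.induction_on with
    | empty =>
      refine ⟨1, D.root_one, ?_, fun k _ => by simp [D.sec_one, D.aPow_zero]⟩
      funext k
      simp [xvec, D.sec_one, H.ε_one]
    | insert i s hi ih =>
      obtain ⟨d, hd, hx, hs⟩ := ih
      have hb : D.root (D.bConj i ^ (y i).val) = 0 := by rw [D.root_pow, D.root_bConj, mul_zero]
      refine ⟨d * D.bConj i ^ (y i).val, by rw [D.root_mul, hd, hb, add_zero], ?_, ?_⟩
      · rw [H.xvec_mul hb, hx]
        funext k
        have : H.xvec (D.bConj i ^ (y i).val) k = y i * H.xvec (D.bConj i) k := by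
          unfold xvec
          rw [D.sec_pow (D.root_bConj i), H.ε_pow, ZMod.natCast_zmod_val]
        rw [Pi.add_apply, this, H.xvec_bConj]
        by_cases hk : k = i
        · subst hk
          simp [hi]
        · simp [hk]
      · intro k hk
        rw [D.sec_mul, hb, add_zero, hs k hk, sum_insert hi, D.sec_pow (D.root_bConj i)]
        by_cases hki : k = i
        · subst hki
          simp [hk]
        · rw [D.sec_bConj_of_ne hki, D.aPow_pow, ← D.aPow_add, ZMod.natCast_zmod_val, add_comm]
  obtain ⟨d, h1, h2, h3⟩ := key univ
  exact ⟨d, h1, by simpa using h2, h3⟩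

/-- At each letter, `η` of a commutator of sections is the symplectic form in their `root` and `ε`,
and the roots are the convolution of `E` with `xvec`. -/
theorem rho_commutatorElement (h0 : E 0 = 0) {g h : Γ} (hg : D.root g = 0) (hh : D.root h = 0) :
    H.rho ⁅g, h⁆ = commForm E (H.xvec g) (H.xvec h) := by
  funext k
  unfold rho
  rw [D.sec_commutatorElement hg hh, H.η_commutatorElement, commForm, ← H.vec_eq_conv h0,
    ← H.vec_eq_conv h0]
  rfl

end Heisenberg

variable (D) [Fact p.Prime]

theorem bConj_mem_stab (i : ZMod p) : D.bConj i ∈ D.stab := D.root_bConj i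

theorem stab_eq_closure : D.stab = Subgroup.closure (Set.range D.bConj) := by
  apply le_antisymm
  · have hconj : ∀ t : ZMod p, ∀ g ∈ Subgroup.closure (Set.range D.bConj),
        D.aPow t * g * (D.aPow t)⁻¹ ∈ Subgroup.closure (Set.range D.bConj) := by
      intro t g hg
      induction hg using Subgroup.closure_induction with
      | mem x hx =>
        obtain ⟨i, rfl⟩ := hx
        refine Subgroup.subset_closure ⟨t + i, ?_⟩
        simp only [bConj, D.aPow_add]
        group
      | one => simp
      | mul x y _ _ hx hy =>
        have := mul_mem hx hy
        convert this using 1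
        group
      | inv x _ hx =>
        have := inv_mem hx
        convert this using 1
        group
    have key : ∀ g : Γ, g * (D.aPow (D.root g))⁻¹ ∈ Subgroup.closure (Set.range D.bConj) := by
      intro g
      have hg : g ∈ Subgroup.closure {D.a, D.b} := by rw [D.closure_eq]; trivial
      induction hg using Subgroup.closure_induction with
      | mem x hx =>
        rcases hx with rfl | rfl
        · rw [D.root_a, D.aPow_one, mul_inv_cancel]
          exact one_mem _
        · rw [D.root_b, D.aPow_zero, inv_one, mul_one]
          refine Subgroup.subset_closure ⟨0, ?_⟩
          simp [bConj, D.aPow_zero]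
      | one => simp [D.root_one, D.aPow_zero]
      | mul x y _ _ hx hy =>
        have := mul_mem hx (hconj (D.root x) _ hy)
        convert this using 1
        rw [D.root_mul, add_comm, D.aPow_add]
        simp only [mul_inv_rev, mul_assoc, inv_mul_cancel_left]
        rw [← mul_inv_rev, ← mul_inv_rev, D.aPow_comm]
      | inv x _ hx =>
        have := hconj (-D.root x) _ (inv_mem hx)
        convert this using 1
        rw [D.root_inv, D.aPow_neg]
        group
    intro g hg
    have := key g
    rwa [D.mem_stab.mp hg, D.aPow_zero, inv_one, mul_one] at this
  · rw [Subgroup.closure_le]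
    rintro _ ⟨i, rfl⟩
    exact D.bConj_mem_stab i

theorem stab_index : D.stab.index = p := by
  let F : Γ →* Multiplicative (ZMod p) :=
    MonoidHom.mk' (fun g => Multiplicative.ofAdd (D.root g))
      (fun g h => by rw [D.root_mul, ofAdd_add])
  have hF : D.stab = F.ker := by
    ext g
    rw [D.mem_stab, MonoidHom.mem_ker]
    exact Multiplicative.ofAdd.injective.eq_iff.symm
  have hs : F.range = ⊤ := by
    rw [MonoidHom.range_eq_top]
    intro t
    exact ⟨D.aPow t.toAdd, congrArg Multiplicative.ofAdd (D.root_aPow _)⟩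
  rw [hF, Subgroup.index_ker, hs, Subgroup.card_top, Nat.card_congr Multiplicative.toAdd,
    Nat.card_zmod]

variable {D}

namespace Heisenberg

variable (H : D.Heisenberg)

/-- `xvec` as a homomorphism on the first level stabilizer. -/
def xHom : D.stab →* Multiplicative (ZMod p → ZMod p) :=
  MonoidHom.mk' (fun g => Multiplicative.ofAdd (H.xvec g)) (fun g h => by
    rw [Subgroup.coe_mul, H.xvec_mul h.2, ofAdd_add])

/-- The abelianization is generated by the classes of the `bConj i`, of order dividing p, and `xHom`
sends them to the standard basis. So it is injective on the abelianization. -/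
theorem ker_xHom : H.xHom.ker = commutator D.stab := by
  apply le_antisymm
  · intro s hs
    let t : ZMod p → D.stab := fun i => ⟨D.bConj i, D.bConj_mem_stab i⟩
    let q := Abelianization.of (G := D.stab)
    have hcl : Subgroup.closure (Set.range t) = ⊤ := by
      apply Subgroup.map_injective D.stab.subtype_injective
      rw [MonoidHom.map_closure, ← Set.range_comp, ← MonoidHom.range_eq_map,
        Subgroup.range_subtype]
      exact D.stab_eq_closure.symm
    have hq : q s ∈ Subgroup.closure (Set.range (q ∘ t)) := by
      rw [Set.range_comp, ← MonoidHom.map_closure, hcl]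
      exact ⟨s, trivial, rfl⟩
    obtain ⟨n, hn⟩ := Subgroup.exists_of_mem_closure_range _ _ hq
    have h1 := congrArg (Abelianization.lift H.xHom) hn
    rw [map_prod] at h1
    simp only [map_zpow, Function.comp_apply, q, Abelianization.lift_apply_of] at h1
    rw [MonoidHom.mem_ker.mp hs] at h1
    have h2 : (0 : ZMod p → ZMod p) = ∑ i, n i • H.xvec (D.bConj i) := by
      have := congrArg Multiplicative.toAdd h1
      rw [toAdd_prod] at this
      exact this
    have h3 : ∀ i, ((n i : ℤ) : ZMod p) = 0 := by
      intro i
      have := congrFun h2 i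
      simp only [H.xvec_bConj] at this
      simpa [Pi.single_apply] using this.symm
    have h4 : q s = 1 := by
      rw [hn]
      refine prod_eq_one fun i _ => zpow_eq_one_of_pow ?_ (h3 i)
      have : t i ^ p = 1 := Subtype.ext (D.bConj_pow_prime i)
      rw [Function.comp_apply, ← map_pow, this, map_one]
    have h5 : s ∈ q.ker := h4
    rwa [Abelianization.ker_of] at h5
  · exact Abelianization.commutator_subset_ker _

theorem map_ker_xHom : H.xHom.ker.map D.stab.subtype = ⁅D.stab, D.stab⁆ := by
  rw [ker_xHom, Subgroup.map_subtype_commutator]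

theorem mem_commutator_stab {g : Γ} :
    g ∈ ⁅D.stab, D.stab⁆ ↔ D.root g = 0 ∧ H.xvec g = 0 := by
  rw [← H.map_ker_xHom]
  constructor
  · rintro ⟨s, hs, rfl⟩
    exact ⟨s.2, hs⟩
  · rintro ⟨h1, h2⟩
    exact ⟨⟨g, h1⟩, h2, rfl⟩

theorem index_commutator_stab (H : D.Heisenberg) : ⁅D.stab, D.stab⁆.index = p ^ (p + 1) := by
  have hs : H.xHom.range = ⊤ := by
    rw [MonoidHom.range_eq_top]
    intro y
    obtain ⟨d, hd, hx, _⟩ := H.exists_prod_bConj y.toAdd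
    exact ⟨⟨d, hd⟩, hx⟩
  rw [← H.map_ker_xHom, Subgroup.index_map_subtype, D.stab_index, Subgroup.index_ker, hs,
    Subgroup.card_top, Nat.card_congr Multiplicative.toAdd, Nat.card_fun, Nat.card_zmod, pow_succ]

theorem rho_mul {g h : Γ} (hg : g ∈ ⁅D.stab, D.stab⁆) (hh : h ∈ ⁅D.stab, D.stab⁆) :
    H.rho (g * h) = H.rho g + H.rho h := by
  rw [H.mem_commutator_stab] at hg hh
  funext k
  unfold rho
  rw [D.sec_mul, hh.1, add_zero, H.η_mul_of_ε (congrFun hg.2 k), Pi.add_apply]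

/-- `rho` as a homomorphism on the derived subgroup of the first level stabilizer. -/
def rhoHom : (⁅D.stab, D.stab⁆ : Subgroup Γ) →* Multiplicative (ZMod p → ZMod p) :=
  MonoidHom.mk' (fun g => Multiplicative.ofAdd (H.rho g)) (fun g h => by
    rw [Subgroup.coe_mul, H.rho_mul g.2 h.2, ofAdd_add])

/-- `rho` sends the commutators that generate `⁅A, A⁆` onto the spanning set of `commSpan E L`. -/
theorem map_rhoHom (h0 : E 0 = 0) {A : Subgroup Γ} (hA : A ≤ D.stab)
    {L : Submodule (ZMod p) (ZMod p → ZMod p)} (hL : ∀ v, v ∈ L ↔ ∃ g ∈ A, H.xvec g = v) :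
    ((⁅A, A⁆.subgroupOf ⁅D.stab, D.stab⁆).map H.rhoHom) =
      (commSpan E L).toAddSubgroup.toSubgroup := by
  have hAK : ⁅A, A⁆ ≤ ⁅D.stab, D.stab⁆ := Subgroup.commutator_mono hA hA
  apply le_antisymm
  · have h1 : ⁅A, A⁆ ≤ ((commSpan E L).toAddSubgroup.toSubgroup.comap H.rhoHom).map
        ⁅D.stab, D.stab⁆.subtype := by
      rw [Subgroup.commutator_le]
      intro g hg h hh
      refine ⟨⟨⁅g, h⁆, hAK (Subgroup.commutator_mem_commutator hg hh)⟩, ?_, rfl⟩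
      change H.rho ⁅g, h⁆ ∈ commSpan E L
      rw [H.rho_commutatorElement h0 (hA hg) (hA hh)]
      exact Submodule.subset_span ⟨_, (hL _).mpr ⟨g, hg, rfl⟩, _, (hL _).mpr ⟨h, hh, rfl⟩, rfl⟩
    rintro _ ⟨g, hg, rfl⟩
    obtain ⟨g', hg', e⟩ := h1 hg
    have : g' = g := Subtype.ext e
    subst this
    exact hg'
  · intro v hv
    -- Over a prime field every additive subgroup is a subspace.
    let P : Submodule (ZMod p) (ZMod p → ZMod p) := AddSubgroup.toZModSubmodule p
      (Subgroup.toAddSubgroup' ((⁅A, A⁆.subgroupOf ⁅D.stab, D.stab⁆).map H.rhoHom))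
    have hP : commSpan E L ≤ P := by
      refine Submodule.span_le.mpr ?_
      rintro _ ⟨x, hx, y, hy, rfl⟩
      obtain ⟨g, hg, rfl⟩ := (hL _).mp hx
      obtain ⟨h, hh, rfl⟩ := (hL _).mp hy
      rw [← H.rho_commutatorElement h0 (hA hg) (hA hh)]
      exact ⟨⟨⁅g, h⁆, hAK (Subgroup.commutator_mem_commutator hg hh)⟩,
        Subgroup.commutator_mem_commutator hg hh, rfl⟩
    exact hP hv

theorem xvec_image_stab (v : ZMod p → ZMod p) :
    v ∈ (⊤ : Submodule (ZMod p) (ZMod p → ZMod p)) ↔ ∃ g ∈ D.stab, H.xvec g = v := by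
  obtain ⟨d, hd, hx, _⟩ := H.exists_prod_bConj v
  exact ⟨fun _ => ⟨d, hd, hx⟩, fun _ => trivial⟩

theorem xvec_image_commutator (v : ZMod p → ZMod p) :
    v ∈ sumZero p ↔ ∃ g ∈ commutator Γ, H.xvec g = v := by
  constructor
  · intro hv
    obtain ⟨d, hd, hx, _⟩ := H.exists_prod_bConj v
    refine ⟨d, H.mem_commutator_iff.mpr ⟨hd, ?_⟩, hx⟩
    rw [← H.sum_xvec, hx]
    exact hv
  · rintro ⟨g, hg, rfl⟩
    rw [mem_sumZero, H.sum_xvec]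
    exact (H.mem_commutator_iff.mp hg).2

/-- As the second derived subgroup contains the kernel of `rho`, its index in the derived stabilizer
equals the index of the corresponding images in F_p^p. Stated as a product to avoid division. -/
theorem index_formula (h0 : E 0 = 0)
    (hker : ∀ g ∈ ⁅D.stab, D.stab⁆, H.rho g = 0 → g ∈ ⁅commutator Γ, commutator Γ⁆) :
    ⁅commutator Γ, commutator Γ⁆.index * (commSpan E ⊤).toAddSubgroup.index =
      (commSpan E (sumZero p)).toAddSubgroup.index * p ^ (p + 1) := by
  have h1 := H.map_rhoHom h0 D.commutator_le_stab H.xvec_image_commutator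
  have h2 := H.map_rhoHom h0 le_rfl H.xvec_image_stab
  rw [Subgroup.subgroupOf_self, ← MonoidHom.range_eq_map] at h2
  have h3 := Subgroup.index_map
    (⁅commutator Γ, commutator Γ⁆.subgroupOf ⁅D.stab, D.stab⁆) H.rhoHom
  have h4 : H.rhoHom.ker ≤ ⁅commutator Γ, commutator Γ⁆.subgroupOf ⁅D.stab, D.stab⁆ :=
    fun g hg => hker g g.2 hg
  rw [sup_eq_left.mpr h4, h1, h2, AddSubgroup.index_toSubgroup, AddSubgroup.index_toSubgroup] at h3
  have h5 := Subgroup.relIndex_mul_index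
    (Subgroup.commutator_mono D.commutator_le_stab D.commutator_le_stab)
  rw [H.index_commutator_stab] at h5
  rw [← h5, h3, Subgroup.relIndex]
  ring

end Heisenberg

end WreathRecursion

/-! ### Elements supported below a single first-level vertex. -/

theorem commute_mk_iff {Γ : Type*} [Group Γ] {R : Subgroup Γ} [R.Normal] {x y : Γ} :
    Commute (QuotientGroup.mk' R x) (QuotientGroup.mk' R y) ↔ ⁅x, y⁆ ∈ R := by
  rw [← commutatorElement_eq_one_iff_commute, ← map_commutatorElement]
  exact QuotientGroup.eq_one_iff _

namespace WreathRecursion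

variable {p : ℕ} {E : ZMod p → ZMod p} {Γ : Type*} [Group Γ] (D : WreathRecursion p E Γ)

/-- The elements `h` such that the automorphism acting as `h` below `0`, and trivially elsewhere, is
in `M`. -/
def rigid (M : Subgroup Γ) : Subgroup Γ where
  carrier := {h | ∃ g ∈ M, D.root g = 0 ∧ D.sec g 0 = h ∧ ∀ k, k ≠ 0 → D.sec g k = 1}
  mul_mem' := by
    rintro _ _ ⟨g, hg, hr, rfl, hk⟩ ⟨g', hg', hr', rfl, hk'⟩
    refine ⟨g * g', M.mul_mem hg hg', by rw [D.root_mul, hr, hr', add_zero], ?_, fun k h => ?_⟩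
    · rw [D.sec_mul, hr', add_zero]
    · rw [D.sec_mul, hr', add_zero, hk k h, hk' k h, one_mul]
  one_mem' := ⟨1, M.one_mem, D.root_one, D.sec_one 0, fun k _ => D.sec_one k⟩
  inv_mem' := by
    rintro _ ⟨g, hg, hr, rfl, hk⟩
    refine ⟨g⁻¹, M.inv_mem hg, by rw [D.root_inv, hr, neg_zero], ?_, fun k h => ?_⟩
    · rw [D.sec_inv, hr, sub_zero]
    · rw [D.sec_inv, hr, sub_zero, hk k h, inv_one]

variable [Fact p.Prime]

/-- Residues act on the powers of `a` transitively. -/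
theorem exists_aPow_pow {s : ZMod p} (hs : s ≠ 0) (t : ZMod p) : ∃ n : ℕ, D.aPow s ^ n = D.aPow t :=
  ⟨(t / s).val, by rw [D.aPow_pow, ZMod.natCast_zmod_val, div_mul_cancel₀ _ hs]⟩

/-- Self-replication: `b` has section `b` at 0, and a conjugate of `b` has there a nontrivial power
of `a`. -/
theorem exists_sec_zero_eq (hE : ∃ m, m ≠ 0 ∧ E m ≠ 0) (t : Γ) :
    ∃ s, D.root s = 0 ∧ D.sec s 0 = t := by
  have ht : t ∈ Subgroup.closure {D.a, D.b} := by rw [D.closure_eq]; trivial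
  induction ht using Subgroup.closure_induction with
  | mem x hx =>
    rcases hx with rfl | rfl
    · obtain ⟨m, hm, hEm⟩ := hE
      obtain ⟨n, hn⟩ := D.exists_aPow_pow hEm 1
      refine ⟨D.bConj (-m) ^ n, by rw [D.root_pow, D.root_bConj, mul_zero], ?_⟩
      rw [D.sec_pow (D.root_bConj _), D.sec_bConj_of_ne (neg_ne_zero.mpr hm).symm, zero_sub,
        neg_neg, hn, D.aPow_one]
    · exact ⟨D.b, D.root_b, D.sec_b_zero⟩
  | one => exact ⟨1, D.root_one, D.sec_one 0⟩
  | mul x y _ _ hx hy =>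
    obtain ⟨s, hs, rfl⟩ := hx
    obtain ⟨s', hs', rfl⟩ := hy
    exact ⟨s * s', by rw [D.root_mul, hs, hs', add_zero], by rw [D.sec_mul, hs', add_zero]⟩
  | inv x _ hx =>
    obtain ⟨s, hs, rfl⟩ := hx
    exact ⟨s⁻¹, by rw [D.root_inv, hs, neg_zero], by rw [D.sec_inv, hs, sub_zero]⟩

theorem rigid_normal (hE : ∃ m, m ≠ 0 ∧ E m ≠ 0) (M : Subgroup Γ) [hM : M.Normal] :
    (D.rigid M).Normal where
  conj_mem := by
    rintro _ ⟨g, hg, hr, rfl, hk⟩ t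
    obtain ⟨s, hs, rfl⟩ := D.exists_sec_zero_eq hE t
    refine ⟨s * g * s⁻¹, hM.conj_mem g hg s, ?_, ?_, fun k h => ?_⟩
    · rw [D.root_mul, D.root_mul, D.root_inv, hr, hs]; ring
    · rw [D.sec_conj hr, hs, sub_zero]
    · rw [D.sec_conj hr, hs, sub_zero, hk k h, mul_one, mul_inv_cancel]

/-- Conjugation by powers of `a` moves the support from 0 to any letter, and the resulting elements
are multiplied. -/
theorem exists_mem_of_sec_mem_rigid (M : Subgroup Γ) [hM : M.Normal] {h : ZMod p → Γ}
    (hh : ∀ k, h k ∈ D.rigid M) : ∃ g ∈ M, D.root g = 0 ∧ ∀ k, D.sec g k = h k := by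
  classical
  have key : ∀ s : Finset (ZMod p), ∃ g ∈ M, D.root g = 0 ∧
      ∀ k, D.sec g k = if k ∈ s then h k else 1 := by
    intro s
    induction s using Finset.induction_on with
    | empty => exact ⟨1, M.one_mem, D.root_one, fun k => by simp [D.sec_one]⟩
    | insert i s hi ih =>
      obtain ⟨g, hg, hr, hs⟩ := ih
      obtain ⟨g', hg', hr', hs0, hs'⟩ := hh i
      have hc : D.root (D.aPow i * g' * (D.aPow i)⁻¹) = 0 := by
        rw [D.root_mul, D.root_mul, D.root_inv, hr']; ring
      refine ⟨g * (D.aPow i * g' * (D.aPow i)⁻¹), M.mul_mem hg (hM.conj_mem _ hg' _),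
        by rw [D.root_mul, hr, hc, add_zero], fun k => ?_⟩
      rw [D.sec_mul, hc, add_zero, hs, D.sec_conj hr', D.root_aPow, D.sec_aPow]
      by_cases hk : k = i
      · subst hk
        simp [hi, hs0]
      · simp [hk, hs' _ (sub_ne_zero.mpr hk)]
  obtain ⟨g, h1, h2, h3⟩ := key univ
  exact ⟨g, h1, h2, by simpa using h3⟩

theorem mem_of_sec_mem_rigid (M : Subgroup Γ) [M.Normal] {g : Γ} (hg : D.root g = 0)
    (hs : ∀ k, D.sec g k ∈ D.rigid M) : g ∈ M := by
  obtain ⟨g', h1, h2, h3⟩ := D.exists_mem_of_sec_mem_rigid M hs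
  rwa [D.ext_of_sec (hg.trans h2.symm) fun k => (h3 k).symm]

section TwoSupport

variable {m : ZMod p}

/-- The commutator of two conjugates of `b` has only two nontrivial sections. -/
theorem commutator_sec_mem_rigid {M : Subgroup Γ} (hm : m ≠ 0) {d : Γ} (hd : D.root d = 0)
    (hdm : D.sec d m = 1) (hM : ⁅⁅D.bConj 0, D.bConj m⁆, d⁆ ∈ M) :
    ⁅⁅D.b, D.aPow (E (-m))⁆, D.sec d 0⁆ ∈ D.rigid M := by
  have hw : D.root ⁅D.bConj 0, D.bConj m⁆ = 0 :=
    D.stab.mul_mem (D.stab.mul_mem (D.stab.mul_mem (D.bConj_mem_stab _) (D.bConj_mem_stab _))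
      (D.stab.inv_mem (D.bConj_mem_stab _))) (D.stab.inv_mem (D.bConj_mem_stab _))
  have hwd : D.root ⁅⁅D.bConj 0, D.bConj m⁆, d⁆ = 0 :=
    D.stab.mul_mem (D.stab.mul_mem (D.stab.mul_mem hw hd) (D.stab.inv_mem hw)) (D.stab.inv_mem hd)
  refine ⟨_, hM, hwd, ?_, fun k hk => ?_⟩
  · rw [D.sec_commutatorElement hw hd, D.sec_commutatorElement (D.root_bConj _) (D.root_bConj _),
      D.sec_bConj_self, D.sec_bConj_of_ne hm.symm, zero_sub]
  · rw [D.sec_commutatorElement hw hd]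
    by_cases hkm : k = m
    · rw [hkm, hdm, commutatorElement_one_right]
    -- Away from 0 and `m` both conjugates of `b` have powers of `a` as sections, which commute.
    · rw [D.sec_commutatorElement (D.root_bConj _) (D.root_bConj _), D.sec_bConj_of_ne hk,
        D.sec_bConj_of_ne hkm, commutatorElement_eq_one_iff_mul_comm.mpr (D.aPow_comm _ _),
        commutatorElement_one_left]

/-- If `E m = 0`, the section at `m` is trivial too, and no further commutator is needed. -/
theorem commutator_mem_rigid {M : Subgroup Γ} (hm : m ≠ 0) (hEm : E m = 0)
    (hM : ⁅D.bConj 0, D.bConj m⁆ ∈ M) : ⁅D.b, D.aPow (E (-m))⁆ ∈ D.rigid M := by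
  have hw : D.root ⁅D.bConj 0, D.bConj m⁆ = 0 :=
    D.stab.mul_mem (D.stab.mul_mem (D.stab.mul_mem (D.bConj_mem_stab _) (D.bConj_mem_stab _))
      (D.stab.inv_mem (D.bConj_mem_stab _))) (D.stab.inv_mem (D.bConj_mem_stab _))
  refine ⟨_, hM, hw, ?_, fun k hk => ?_⟩
  · rw [D.sec_commutatorElement (D.root_bConj _) (D.root_bConj _),
      D.sec_bConj_self, D.sec_bConj_of_ne hm.symm, zero_sub]
  · rw [D.sec_commutatorElement (D.root_bConj _) (D.root_bConj _), D.sec_bConj_of_ne hk]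
    by_cases hkm : k = m
    · rw [hkm, sub_zero, hEm, D.aPow_zero, commutatorElement_one_left]
    · rw [D.sec_bConj_of_ne hkm, commutatorElement_eq_one_iff_mul_comm.mpr (D.aPow_comm _ _)]

end TwoSupport

variable {D}

namespace Heisenberg

variable (H : D.Heisenberg)

/-- A normal subgroup contains the kernel as soon as one commutator `⁅b, a ^ t⁆` is central
modulo it. -/
theorem kernel_le_of_commutator {R : Subgroup Γ} [R.Normal] {t s s' : ZMod p} (ht : t ≠ 0)
    (hs : s ≠ 0) (ha : ⁅⁅D.b, D.aPow t⁆, D.aPow s⁆ ∈ R)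
    (hb : ⁅⁅D.b, D.aPow t⁆, D.b * D.aPow s'⁆ ∈ R) : H.kernel ≤ R := by
  rw [← commute_mk_iff] at ha hb
  have hq : ∀ u, Commute (QuotientGroup.mk' R ⁅D.b, D.aPow t⁆) (QuotientGroup.mk' R (D.aPow u)) := by
    intro u
    obtain ⟨n, hn⟩ := D.exists_aPow_pow hs u
    rw [← hn, map_pow]
    exact ha.pow_right n
  have hqb : Commute (QuotientGroup.mk' R ⁅D.b, D.aPow t⁆) (QuotientGroup.mk' R D.b) := by
    have := hb.mul_right (hq s').inv_right
    rwa [← map_inv, ← map_mul, mul_inv_cancel_right] at this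
  obtain ⟨n, hn⟩ := D.exists_aPow_pow ht 1
  rw [D.aPow_one] at hn
  -- With c = ⁅b, a^t⁆ central and a = (a^t)^n, conjugating `a` by `b` gives (c a^t)^n = c^n a, so
  -- `⁅a, b⁆` is central as well.
  have h1 : QuotientGroup.mk' R ⁅D.a, D.b⁆ = (QuotientGroup.mk' R ⁅D.b, D.aPow t⁆ ^ n)⁻¹ := by
    have e1 : D.b * D.a * D.b⁻¹ = (⁅D.b, D.aPow t⁆ * D.aPow t) ^ n := by
      rw [← hn, ← conj_pow, commutatorElement_def]
      group
    have e2 := congrArg (QuotientGroup.mk' R) e1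
    rw [map_pow, map_mul _ _ (D.aPow t), (hq t).mul_pow, ← map_pow _ (D.aPow t), hn] at e2
    rw [← commutatorElement_inv, map_inv, inv_inj, commutatorElement_def, map_mul, e2, map_inv,
      mul_inv_cancel_right]
  refine H.kernel_le (R := R) ?_ ?_
  · rw [← commute_mk_iff, h1, ← D.aPow_one]
    exact ((hq 1).pow_left n).inv_left
  · rw [← commute_mk_iff, h1]
    exact (hqb.pow_left n).inv_left

theorem sec_mem_kernel (h0 : E 0 = 0) {g : Γ} (hg : g ∈ ⁅D.stab, D.stab⁆) {k : ZMod p}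
    (hk : H.rho g k = 0) : D.sec g k ∈ H.kernel := by
  rw [H.mem_commutator_stab] at hg
  refine ⟨?_, congrFun hg.2 k, hk⟩
  have := congrFun (H.vec_eq_conv h0 g) k
  rw [hg.2] at this
  exact this.trans (by simp [conv])

theorem mem_of_rho_eq_zero (h0 : E 0 = 0) {M : Subgroup Γ} [M.Normal]
    (hM : H.kernel ≤ D.rigid M) {g : Γ} (hg : g ∈ ⁅D.stab, D.stab⁆) (hk : H.rho g = 0) : g ∈ M :=
  D.mem_of_sec_mem_rigid M (H.mem_commutator_stab.mp hg).1
    fun k => hM (H.sec_mem_kernel h0 hg (congrFun hk k))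

section Products

variable {m : ZMod p} {M : Subgroup Γ} {y : ZMod p → ZMod p}

/-- Here d is the product of the powers b_i^(y_i); it avoids b_0 and b_m, so its sections at 0 and
`m` are powers of `a` given by the convolution. `M` is left open: for the derived subgroup every d
is allowed, for the second only those with `ε d = 0`. -/
theorem commutator_aPow_mem_rigid (hm : m ≠ 0) (hy0 : y 0 = 0) (hym : y m = 0)
    (hc : conv E y m = 0)
    (hM : ∀ d, D.root d = 0 → H.ε d = ∑ i, y i → ⁅⁅D.bConj 0, D.bConj m⁆, d⁆ ∈ M) :
    ⁅⁅D.b, D.aPow (E (-m))⁆, D.aPow (conv E y 0)⁆ ∈ D.rigid M := by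
  obtain ⟨d, hd, hx, hs⟩ := H.exists_prod_bConj y
  rw [← hs 0 hy0]
  refine D.commutator_sec_mem_rigid hm hd ?_ (hM d hd ?_)
  · rw [hs m hym, hc, D.aPow_zero]
  · rw [← H.sum_xvec, hx]

/-- The additional factor b_0 contributes `b` at 0 and a^(E m) at `m`; the latter is cancelled by
the tuple. -/
theorem commutator_b_mul_aPow_mem_rigid (hm : m ≠ 0) (hy0 : y 0 = 0) (hym : y m = 0)
    (hc : conv E y m = -E m)
    (hM : ∀ d, D.root d = 0 → H.ε d = 1 + ∑ i, y i → ⁅⁅D.bConj 0, D.bConj m⁆, d⁆ ∈ M) :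
    ⁅⁅D.b, D.aPow (E (-m))⁆, D.b * D.aPow (conv E y 0)⁆ ∈ D.rigid M := by
  obtain ⟨d, hd, hx, hs⟩ := H.exists_prod_bConj y
  have hr : D.root (D.bConj 0 * d) = 0 := by rw [D.root_mul, D.root_bConj, hd, add_zero]
  have h0 : D.sec (D.bConj 0 * d) 0 = D.b * D.aPow (conv E y 0) := by
    rw [D.sec_mul, hd, add_zero, D.sec_bConj_self, hs 0 hy0]
  rw [← h0]
  refine D.commutator_sec_mem_rigid hm hr ?_ (hM _ hr ?_)
  · rw [D.sec_mul, hd, add_zero, hs m hym, hc, D.sec_bConj_of_ne hm, ← D.aPow_add, sub_zero,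
      add_neg_cancel, D.aPow_zero]
  · rw [← H.sum_xvec, H.xvec_mul hd, hx, H.xvec_bConj]
    simp [sum_add_distrib]

end Products

/-- If the derived subgroup contains `Γ'` on one vertex, the second derived subgroup contains the
kernel there. -/
theorem kernel_le_rigid_of_commutator_mem (hE : ¬ ∃ u, ∀ m, m ≠ 0 → E m = u)
    (hE' : ∃ m, m ≠ 0 ∧ E m ≠ 0) (hc : ⁅D.b, D.aPow 1⁆ ∈ D.rigid (commutator Γ)) :
    H.kernel ≤ D.rigid ⁅commutator Γ, commutator Γ⁆ := by
  have := D.rigid_normal hE' ⁅commutator Γ, commutator Γ⁆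
  have key : ∀ d, d ∈ commutator Γ →
      ⁅⁅D.b, D.aPow 1⁆, D.sec d 0⁆ ∈ D.rigid ⁅commutator Γ, commutator Γ⁆ := by
    intro d hd
    obtain ⟨g, hg, hr, hg0, hk⟩ := hc
    have hd' : D.root d = 0 := D.commutator_le_stab hd
    have hm := Subgroup.commutator_mem_commutator hg hd
    refine ⟨⁅g, d⁆, hm, D.commutator_le_stab (Subgroup.commutator_le_left _ _ hm), ?_, ?_⟩
    · rw [D.sec_commutatorElement hr hd', hg0]
    · intro k h
      rw [D.sec_commutatorElement hr hd', hk k h, commutatorElement_one_left]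
  obtain ⟨i, hi, j, hj, hij⟩ : ∃ i, i ≠ 0 ∧ ∃ j, j ≠ 0 ∧ E i ≠ E j := by
    obtain ⟨m, hm, _⟩ := hE'
    by_contra! h
    exact hE ⟨E m, fun k hk => h k hk m hm⟩
  have hi' := neg_ne_zero.mpr hi
  have hj' := neg_ne_zero.mpr hj
  have hrb : ∀ k, D.root (D.bConj k)⁻¹ = 0 := fun k => D.stab.inv_mem (D.bConj_mem_stab k)
  have hsb : ∀ k, k ≠ 0 → D.sec (D.bConj (-k))⁻¹ 0 = D.aPow (-E k) := fun k hk => by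
    rw [D.sec_inv, D.root_bConj, sub_zero, D.sec_bConj_of_ne (neg_ne_zero.mpr hk).symm, zero_sub,
      neg_neg, D.aPow_neg]
  have hε : ∀ k, H.ε (D.bConj k) = 1 := fun k => by
    rw [← H.sum_xvec, H.xvec_bConj]
    simp
  have hmem : ∀ k l, D.bConj k * (D.bConj l)⁻¹ ∈ commutator Γ := fun k l => by
    rw [H.mem_commutator_iff, D.root_mul, D.root_bConj, hrb, H.ε_mul, H.ε_inv, hε, hε]
    simp
  -- The elements b_{-i} b_{-j}⁻¹ and b_0 b_{-i}⁻¹ of the derived subgroup have sections a^(E i - E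
  -- j) and b a^(-E i) at 0.
  refine H.kernel_le_of_commutator (t := 1) (s := E i - E j) (s' := -E i) one_ne_zero
    (sub_ne_zero.mpr hij) ?_ ?_
  · have := key _ (hmem (-i) (-j))
    rwa [D.sec_mul, hrb, add_zero, hsb j hj, D.sec_bConj_of_ne hi'.symm, zero_sub, neg_neg,
      ← D.aPow_add, ← sub_eq_add_neg] at this
  · have := key _ (hmem 0 (-i))
    rwa [D.sec_mul, hrb, add_zero, hsb i hi, D.sec_bConj_self] at this

/-- For non-symmetric `E` the map `rho` is onto, so some g in the derived stabilizer has `rho g`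
supported at 0 with value -1. Its other sections lie in the kernel and can be removed inside
`commutator Γ`; its section at 0 agrees with `⁅b, a⁆` modulo the kernel. -/
theorem commutator_mem_rigid_of_not_symmetric (h0 : E 0 = 0) (hE : ¬ ∀ m, E (-m) = E m)
    (hE' : ∃ m, m ≠ 0 ∧ E m ≠ 0) (hM : H.kernel ≤ D.rigid (commutator Γ)) :
    ⁅D.b, D.aPow 1⁆ ∈ D.rigid (commutator Γ) := by
  classical
  have hU := index_commSpan_top h0 (by obtain ⟨m, _, hm⟩ := hE'; exact ⟨m, hm⟩)
  rw [if_neg hE, pow_zero, AddSubgroup.index_eq_one] at hU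
  have hmap := H.map_rhoHom h0 le_rfl H.xvec_image_stab
  have : Multiplicative.ofAdd (Pi.single 0 (-1) : ZMod p → ZMod p) ∈
      (⁅D.stab, D.stab⁆.subgroupOf ⁅D.stab, D.stab⁆).map H.rhoHom := by
    rw [hmap, hU]
    trivial
  obtain ⟨⟨g, hg⟩, _, hρ⟩ := this
  have hρ' : H.rho g = Pi.single 0 (-1) := hρ
  have hg' : g ∈ commutator Γ := Subgroup.commutator_mono le_top le_top hg
  have hr : D.root g = 0 := D.commutator_le_stab hg'
  obtain ⟨g', h1, h2, h3⟩ := D.exists_mem_of_sec_mem_rigid (commutator Γ)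
    (h := fun k => if k = 0 then 1 else D.sec g k) (fun k => by
      by_cases hk : k = 0
      · simp [hk]
      · rw [if_neg hk]
        refine hM (H.sec_mem_kernel h0 hg ?_)
        rw [hρ', Pi.single_eq_of_ne hk])
  have hmem : D.sec g 0 ∈ D.rigid (commutator Γ) := by
    refine ⟨g * g'⁻¹, mul_mem hg' (inv_mem h1), ?_, ?_, fun k hk => ?_⟩
    · rw [D.root_mul, D.root_inv, hr, h2]; simp
    · rw [D.sec_mul, D.root_inv, h2, neg_zero, add_zero, D.sec_inv, h2, sub_zero, h3]
      simp
    · rw [D.sec_mul, D.root_inv, h2, neg_zero, add_zero, D.sec_inv, h2, sub_zero, h3, if_neg hk]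
      simp
  have hx := H.mem_commutator_stab.mp hg
  have hs0 : D.root (D.sec g 0) = 0 := by
    have := congrFun (H.vec_eq_conv h0 g) 0
    rw [hx.2] at this
    exact this.trans (by simp [conv])
  have hε0 : H.ε (D.sec g 0) = 0 := congrFun hx.2 0
  have hη0 : H.η (D.sec g 0) = -1 := by
    have := congrFun hρ' 0
    rwa [Pi.single_eq_same] at this
  have hcε := H.ε_commutatorElement D.b (D.aPow 1)
  have hcη : H.η ⁅D.b, D.aPow 1⁆ = -1 := by
    rw [H.η_commutatorElement, D.root_b, D.root_aPow, H.ε_b]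
    ring
  have hcr : D.root ⁅D.b, D.aPow 1⁆ = 0 := by
    rw [commutatorElement_def]
    simp only [D.root_mul, D.root_inv]
    ring
  have hker : ⁅D.b, D.aPow 1⁆ * (D.sec g 0)⁻¹ ∈ H.kernel := by
    refine ⟨?_, ?_, ?_⟩
    · rw [D.root_mul, D.root_inv, hcr, hs0]; simp
    · rw [H.ε_mul, H.ε_inv, hcε, hε0]; simp
    · rw [H.η_mul_of_ε hcε, H.η_inv hε0, hcη, hη0]; simp
  have := mul_mem (hM hker) hmem
  rwa [inv_mul_cancel_right] at this

end Heisenberg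

end WreathRecursion

/-! ### Existence of the exponent tuples. -/

section Tuples

variable {p : ℕ} [Fact p.Prime] {E : ZMod p → ZMod p}

theorem natCast_ne_zero_of_lt {n : ℕ} (h1 : 0 < n) (h2 : n < p) : (n : ZMod p) ≠ 0 := by
  rw [Ne, ZMod.natCast_eq_zero_iff]
  exact fun h => absurd (Nat.le_of_dvd h1 h) (by omega)

/-- A nonzero residue is a multiple `(n + 1) * m` with `n + 1 < p`. -/
theorem exists_eq_succ_mul {m k : ZMod p} (hm : m ≠ 0) (hk : k ≠ 0) :
    ∃ n : ℕ, n + 1 < p ∧ k = ((n + 1 : ℕ) : ZMod p) * m := by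
  have h1 : (k / m).val ≠ 0 := by
    rw [Ne, ZMod.val_eq_zero, div_eq_zero_iff]
    tauto
  have h2 := ZMod.val_lt (k / m)
  refine ⟨(k / m).val - 1, by omega, ?_⟩
  rw [Nat.sub_add_cancel (by omega), ZMod.natCast_zmod_val, div_mul_cancel₀ _ hm]

theorem ne_of_two_le {m : ZMod p} (hm : m ≠ 0) {n : ℕ} (hn : n + 2 < p) :
    ((n + 2 : ℕ) : ZMod p) * m ≠ 0 ∧ ((n + 2 : ℕ) : ZMod p) * m ≠ m := by
  refine ⟨mul_ne_zero (natCast_ne_zero_of_lt (by omega) hn) hm, fun h => ?_⟩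
  have : ((n + 1 : ℕ) : ZMod p) * m = 0 := by
    push_cast at *
    linear_combination h
  exact mul_ne_zero (natCast_ne_zero_of_lt (by omega) (by omega)) hm this

theorem pred_mul_eq_neg {m : ZMod p} (hp : 2 ≤ p) :
    ((p - 2 + 1 : ℕ) : ZMod p) * m = -m := by
  have : ((p - 2 + 1 : ℕ) : ZMod p) = -1 := by
    have h : p - 2 + 1 + 1 = p := by omega
    have := (congrArg (Nat.cast : ℕ → ZMod p) h).trans (CharP.cast_eq_zero (ZMod p) p)
    push_cast at *
    linear_combination this
  rw [this]; ring

theorem exists_ne_of_not_const {m : ZMod p} (hp : p ≠ 2) (hm : m ≠ 0) (hs : E (-m) = E m)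
    (hE : ¬ ∃ u, ∀ m, m ≠ 0 → E m = u) :
    ∃ i j, i ≠ 0 ∧ i ≠ m ∧ j ≠ 0 ∧ j ≠ m ∧ E (m - i) ≠ E (m - j) := by
  have hmm : -m ≠ m := by
    intro h
    have : (2 : ZMod p) * m = 0 := by linear_combination -h
    exact mul_ne_zero (by exact_mod_cast ZMod.prime_ne_zero p 2 hp) hm this
  by_contra! h
  have h' : ∀ k, k ≠ 0 → k ≠ m → E k = E (-m) := by
    intro k hk hkm
    have := h (m - k) (m - -m) (sub_ne_zero.mpr (Ne.symm hkm)) (by simpa using hk)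
      (sub_ne_zero.mpr hmm.symm) (by simpa using hm)
    simpa using this
  refine hE ⟨E (-m), fun k hk => ?_⟩
  by_cases hkm : k = m
  · rw [hkm, hs]
  · exact h' k hk hkm

/-- Along m, 2m, …, (p-1)m the values would be an orbit of x ↦ u + vx that returns to its start
after p - 2 steps. For v = 1 this gives (p-2)u = 0. Otherwise Fermat leaves only v = 0 or a start at
the fixed point. The orbit is constant in every case. -/
theorem not_affine_recursion {m u v : ZMod p} (hp : p ≠ 2) (hm : m ≠ 0) (hs : E (-m) = E m)
    (hE : ¬ ∃ u, ∀ m, m ≠ 0 → E m = u) :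
    ¬ ∀ k, k ≠ 0 → k ≠ m → E k = u + v * E (k - m) := by
  intro h
  have hp2 : 2 ≤ p := (Fact.out : p.Prime).two_le
  have hp3 : 3 ≤ p := by omega
  have hG : ∀ n : ℕ, n + 2 < p →
      E (((n + 1 + 1 : ℕ) : ZMod p) * m) = u + v * E (((n + 1 : ℕ) : ZMod p) * m) := by
    intro n hn
    obtain ⟨h1, h2⟩ := ne_of_two_le hm hn
    rw [h _ h1 h2]
    congr 3
    push_cast
    ring
  have hend : E (((p - 2 + 1 : ℕ) : ZMod p) * m) = E m := by rw [pred_mul_eq_neg hp2, hs]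
  have hconst : (∀ n : ℕ, n + 1 < p → E (((n + 1 : ℕ) : ZMod p) * m) = E m) → False := by
    intro hc
    refine hE ⟨E m, fun k hk => ?_⟩
    obtain ⟨n, hn, rfl⟩ := exists_eq_succ_mul hm hk
    exact hc n hn
  by_cases hv : v = 1
  · subst hv
    have hc : ∀ n : ℕ, n + 1 < p → E (((n + 1 : ℕ) : ZMod p) * m) = E m + n * u := by
      intro n
      induction n with
      | zero => intro _; simp
      | succ n ih =>
        intro hn
        rw [hG n (by omega), ih (by omega)]
        push_cast
        ring
    have := hc (p - 2) (by omega)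
    rw [hend] at this
    have hu : u = 0 := by
      have h0 : ((p - 2 : ℕ) : ZMod p) * u = 0 := by linear_combination -this
      exact (mul_eq_zero.mp h0).resolve_left (natCast_ne_zero_of_lt (by omega) (by omega))
    refine hconst fun n hn => ?_
    rw [hc n hn, hu, mul_zero, add_zero]
  · have hv1 : (1 : ZMod p) - v ≠ 0 := sub_ne_zero.mpr (Ne.symm hv)
    obtain ⟨w, hw⟩ : ∃ w, u = w * (1 - v) := ⟨u / (1 - v), (div_mul_cancel₀ u hv1).symm⟩
    have hc : ∀ n : ℕ, n + 1 < p → E (((n + 1 : ℕ) : ZMod p) * m) = w + v ^ n * (E m - w) := by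
      intro n
      induction n with
      | zero => intro _; simp
      | succ n ih =>
        intro hn
        rw [hG n (by omega), ih (by omega), hw]
        ring
    have hl := hc (p - 2) (by omega)
    rw [hend] at hl
    have hvp : v ^ (p - 2) * v ^ 2 = v := by
      rw [← pow_add, Nat.sub_add_cancel hp2, ZMod.pow_card]
    have h3 : v * (1 - v) * (E m - w) = 0 := by
      linear_combination -v ^ 2 * hl - (E m - w) * hvp
    rcases mul_eq_zero.mp h3 with h4 | h4
    · have hv0 := (mul_eq_zero.mp h4).resolve_right hv1
      rw [hv0, zero_pow (by omega), zero_mul, add_zero] at hl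
      refine hconst fun n hn => ?_
      rw [hc n hn, hl]
      ring
    · refine hconst fun n hn => ?_
      rw [hc n hn, h4]
      linear_combination -h4

/-- If the first tuple did not exist, then off {0, m} the function E(-k) would be a linear
combination of 1 and E(m-k), which `not_affine_recursion` excludes. The second tuple solves two
equations on the support {i, j}. -/
theorem exists_tuples_of_symmetric (hp : p ≠ 2) (hs : ∀ m, E (-m) = E m)
    (hE : ¬ ∃ u, ∀ m, m ≠ 0 → E m = u) {m : ZMod p} (hm : m ≠ 0) :
    (∃ y : ZMod p → ZMod p, y 0 = 0 ∧ y m = 0 ∧ ∑ i, y i = 0 ∧ conv E y m = 0 ∧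
      conv E y 0 ≠ 0) ∧
    ∃ y : ZMod p → ZMod p, y 0 = 0 ∧ y m = 0 ∧ 1 + ∑ i, y i = 0 ∧ conv E y m = -E m := by
  obtain ⟨i, j, hi, him, hj, hjm, hij⟩ := exists_ne_of_not_const hp hm (hs m) hE
  have hd : E (m - i) - E (m - j) ≠ 0 := sub_ne_zero.mpr hij
  constructor
  · obtain ⟨k, hk, hkm, hne⟩ : ∃ k, k ≠ 0 ∧ k ≠ m ∧ (E (m - i) - E (m - j)) * E (-k) ≠
        (E (m - k) - E (m - j)) * E (-i) + (E (m - i) - E (m - k)) * E (-j) := by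
      by_contra! h
      refine not_affine_recursion (E := E) (m := m)
        (u := (E (m - i) * E (-j) - E (m - j) * E (-i)) / (E (m - i) - E (m - j)))
        (v := (E (-i) - E (-j)) / (E (m - i) - E (m - j))) hp hm (hs m) hE fun k hk hkm => ?_
      have := h k hk hkm
      rw [hs k] at this
      have e : E (k - m) = E (m - k) := by rw [← hs, neg_sub]
      rw [e]
      field_simp
      linear_combination this
    -- The coefficients are the cofactors that solve the two equations `∑ y = 0` and `conv E y m =
    -- 0` on the support {i, j, k}.
    refine ⟨Pi.single k (E (m - i) - E (m - j)) - Pi.single i (E (m - k) - E (m - j))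
      - Pi.single j (E (m - i) - E (m - k)), ?_, ?_, ?_, ?_, ?_⟩
    · simp [hk.symm, hi.symm, hj.symm]
    · simp [hkm.symm, him.symm, hjm.symm]
    · simp [sum_sub_distrib]
    · rw [conv_sub, conv_sub, conv_single, conv_single, conv_single]
      ring
    · rw [conv_sub, conv_sub, conv_single, conv_single, conv_single]
      simp only [zero_sub]
      intro h
      exact hne (by linear_combination h)
  · refine ⟨Pi.single i ((E (m - j) - E m) / (E (m - i) - E (m - j)))
      + Pi.single j ((E m - E (m - i)) / (E (m - i) - E (m - j))), ?_, ?_, ?_, ?_⟩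
    · simp [hi.symm, hj.symm]
    · simp [him.symm, hjm.symm]
    · simp only [Pi.add_apply, sum_add_distrib, Finset.sum_pi_single', mem_univ, if_true]
      field_simp
      ring
    · rw [conv_add, conv_single, conv_single]
      field_simp
      ring

/-- If no tuple exists, E(-k) and E(n-k) are proportional off {0, n} whenever `E (-n) ≠ 0`. Taking n
= m makes `E` geometric along -m, -2m, …; taking n = 2m, for p ≥ 5, forces ratio 1 and thus `E m = E
(-m)`. -/
theorem exists_tuples_of_not_symmetric (hp : p ≠ 2) (h0 : E 0 = 0) (hs : ¬ ∀ m, E (-m) = E m)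
    (hz : ∀ m, E m = 0 → E (-m) = 0) :
    (∃ m, m ≠ 0 ∧ E (-m) ≠ 0 ∧
      ∃ y : ZMod p → ZMod p, y 0 = 0 ∧ y m = 0 ∧ conv E y m = 0 ∧ conv E y 0 ≠ 0) ∨ p = 3 := by
  have hp2 : 2 ≤ p := (Fact.out : p.Prime).two_le
  by_contra! hcon
  obtain ⟨hcon, hp3⟩ := hcon
  have hp4 : p ≠ 4 := by
    rintro rfl
    exact absurd (Fact.out : Nat.Prime 4) (by norm_num)
  have hp5 : 5 ≤ p := by omega
  push Not at hs
  obtain ⟨m, hne⟩ := hs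
  have hm : m ≠ 0 := by rintro rfl; simp at hne
  have hEm : E m ≠ 0 := fun h => hne (by rw [h, hz m h])
  have hEm' : E (-m) ≠ 0 := fun h => hEm (by simpa using hz _ h)
  have hprop : ∀ n, n ≠ 0 → E (-n) ≠ 0 → ∀ i j, i ≠ 0 → i ≠ n → j ≠ 0 → j ≠ n →
      E (-i) * E (n - j) = E (-j) * E (n - i) := by
    intro n hn hEn i j hi hin hj hjn
    have := hcon n hn hEn (Pi.single i (E (n - j)) - Pi.single j (E (n - i)))
      (by simp [hi.symm, hj.symm]) (by simp [hin.symm, hjn.symm])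
      (by rw [conv_sub, conv_single, conv_single]; ring)
    rw [conv_sub, conv_single, conv_single] at this
    simp only [zero_sub] at this
    linear_combination this
  have h2 : (2 : ZMod p) ≠ 0 := by exact_mod_cast ZMod.prime_ne_zero p 2 hp
  set v := E (-(2 * m)) / E (-m) with hv
  have hrec : ∀ k, k ≠ 0 → k ≠ m → E (-k) = v * E (m - k) := by
    intro k hk hkm
    have := hprop m hm hEm' k (2 * m) hk hkm (mul_ne_zero h2 hm)
      (fun h => hm (by linear_combination h))
    have e : m - 2 * m = -m := by ring
    rw [e] at this
    rw [hv]
    field_simp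
    linear_combination this
  have hG : ∀ n : ℕ, n + 1 < p → E (-(((n + 1 : ℕ) : ZMod p) * m)) = v ^ n * E (-m) := by
    intro n
    induction n with
    | zero => intro _; simp
    | succ n ih =>
      intro hn
      obtain ⟨h1, h2⟩ := ne_of_two_le hm hn
      rw [hrec _ h1 h2, pow_succ, mul_right_comm, ← ih (by omega), mul_comm]
      congr 2
      push_cast
      ring
  have hlast := hG (p - 2) (by omega)
  rw [pred_mul_eq_neg hp2, neg_neg] at hlast
  have hv0 : v ≠ 0 := by
    intro h
    rw [h, zero_pow (by omega), zero_mul] at hlast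
    exact hEm hlast
  have hE2 : E (-(2 * m)) = v * E (-m) := by rw [hv, div_mul_cancel₀ _ hEm']
  have hE3 : E (-(3 * m)) = v ^ 2 * E (-m) := by
    have := hG 2 (by omega)
    norm_num at this
    exact this
  have h3 : (3 : ZMod p) ≠ 0 := by
    have := natCast_ne_zero_of_lt (p := p) (n := 3) (by omega) (by omega)
    exact_mod_cast this
  have hfin := hprop (2 * m) (mul_ne_zero h2 hm) (by rw [hE2]; exact mul_ne_zero hv0 hEm') m (3 * m)
    hm (fun h => hm (by linear_combination -h)) (mul_ne_zero h3 hm)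
    (fun h => hm (by linear_combination h))
  have e1 : 2 * m - 3 * m = -m := by ring
  have e2 : 2 * m - m = m := by ring
  rw [e1, e2, hE3] at hfin
  have hvp : v ^ (p - 2) * v ^ 2 = v := by
    rw [← pow_add, Nat.sub_add_cancel hp2, ZMod.pow_card]
  have h4 : (1 - v) * (E (-m) * E (-m)) = 0 := by
    linear_combination hfin + v ^ 2 * E (-m) * hlast + E (-m) * E (-m) * hvp
  have hv1 : v = 1 := by
    have := (mul_eq_zero.mp h4).resolve_right (mul_ne_zero hEm' hEm')
    linear_combination -this
  rw [hv1, one_pow, one_mul] at hlast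
  exact hne hlast.symm

end Tuples

/-! ### The second derived subgroup contains the kernel below each vertex. -/

namespace WreathRecursion.Heisenberg

variable {p : ℕ} [Fact p.Prime] {E : ZMod p → ZMod p} {Γ : Type*} [Group Γ]
  {D : WreathRecursion p E Γ} (H : D.Heisenberg)

theorem commutator_mem_commutator (g h : Γ) : ⁅g, h⁆ ∈ commutator Γ :=
  Subgroup.commutator_mem_commutator (Subgroup.mem_top _) (Subgroup.mem_top _)

theorem kernel_le_rigid_of_symmetric (hp : p ≠ 2) (hs : ∀ m, E (-m) = E m)
    (hE : ¬ ∃ u, ∀ m, m ≠ 0 → E m = u) (hE' : ∃ m, m ≠ 0 ∧ E m ≠ 0) :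
    H.kernel ≤ D.rigid ⁅commutator Γ, commutator Γ⁆ := by
  have := D.rigid_normal hE' ⁅commutator Γ, commutator Γ⁆
  obtain ⟨m, hm, hEm⟩ := hE'
  obtain ⟨⟨y, hy0, hym, hys, hyc, hyn⟩, z, hz0, hzm, hzs, hzc⟩ :=
    exists_tuples_of_symmetric hp hs hE hm
  have hmem : ∀ d, D.root d = 0 → H.ε d = 0 →
      ⁅⁅D.bConj 0, D.bConj m⁆, d⁆ ∈ ⁅commutator Γ, commutator Γ⁆ := fun d hd he =>
    Subgroup.commutator_mem_commutator (commutator_mem_commutator _ _)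
      (H.mem_commutator_iff.mpr ⟨hd, he⟩)
  exact H.kernel_le_of_commutator (by rwa [hs]) hyn
    (H.commutator_aPow_mem_rigid hm hy0 hym hyc fun d hd he => hmem d hd (he.trans hys))
    (H.commutator_b_mul_aPow_mem_rigid hm hz0 hzm hzc fun d hd he => hmem d hd (he.trans hzs))

/-- If `⁅b, α⁆` commutes with `b * α⁻¹` and `⁅b, α⁻¹⁆`
commutes with `b * α`, where `α ^ 3 = 1`, then `⁅b, α⁆` commutes with `α`. -/
theorem commute_of_pow_three {Q : Type*} [Group Q] {α b : Q} (hα : α ^ 3 = 1)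
    (h1 : Commute ⁅b, α⁆ (b * α⁻¹)) (h2 : Commute ⁅b, α⁻¹⁆ (b * α)) : Commute ⁅b, α⁆ α := by
  set c := ⁅b, α⁆ with hc
  have e1 : α * ⁅b, α⁻¹⁆ * α⁻¹ = c⁻¹ := by
    rw [hc, commutatorElement_inv, commutatorElement_def, commutatorElement_def]
    group
  have e2 : α * (b * α) * α⁻¹ = c⁻¹ * (b * α) := by
    rw [hc, commutatorElement_inv, commutatorElement_def]
    group
  -- Conjugation by α turns the second hypothesis into one about c: c commutes with bα, hence with
  -- (bα⁻¹)⁻¹(bα) = α^2, and α = (α^2)^2.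
  have h3 : Commute (α * ⁅b, α⁻¹⁆ * α⁻¹) (α * (b * α) * α⁻¹) := (Commute.conj_iff α).mpr h2
  rw [e1, e2] at h3
  have h4 : Commute c (b * α) := by
    have := (Commute.refl c).mul_right (Commute.inv_left_iff.mp h3)
    simpa using this
  have h5 : Commute c (α ^ 2) := by
    have := h1.inv_right.mul_right h4
    have e : (b * α⁻¹)⁻¹ * (b * α) = α ^ 2 := by rw [pow_two]; group
    rwa [e] at this
  have h6 : (α ^ 2) ^ 2 = α := by
    rw [← pow_mul, show 2 * 2 = 3 + 1 from rfl, pow_succ, hα, one_mul]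
  rw [← h6]
  exact h5.pow_right 2

/-- If `E m = 0` but `E (-m) ≠ 0` for some m, the commutator ⁅b_0, b_m⁆ is already supported at 0.
Otherwise the zero set is symmetric and tuples are used, without a condition on their sum; p = 3 has
too few letters and is treated by `commute_of_pow_three`. -/
theorem kernel_le_rigid_commutator (hp : p ≠ 2) (h0 : E 0 = 0) (hs : ¬ ∀ m, E (-m) = E m)
    (hE' : ∃ m, m ≠ 0 ∧ E m ≠ 0) : H.kernel ≤ D.rigid (commutator Γ) := by
  have hR := D.rigid_normal hE' (commutator Γ)
  have h2 : (2 : ZMod p) ≠ 0 := by exact_mod_cast ZMod.prime_ne_zero p 2 hp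
  by_cases hz : ∀ m, E m = 0 → E (-m) = 0
  · have hb : ∀ m, m ≠ 0 → E (-m) ≠ 0 →
        ⁅⁅D.b, D.aPow (E (-m))⁆, D.b * D.aPow (-E m / E (-m) * E (-(2 * m)))⁆ ∈
          D.rigid (commutator Γ) := by
      intro m hm hEm
      have h := H.commutator_b_mul_aPow_mem_rigid (M := commutator Γ)
        -- One factor at 2m suffices: its section at m has exponent a multiple of `E (m - 2m) = E
        -- (-m) ≠ 0`.
        (y := Pi.single (2 * m) (-E m / E (-m))) hm
        (by simp [(mul_ne_zero h2 hm).symm])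
        (by rw [Pi.single_eq_of_ne]; exact fun h => hm (by linear_combination -h))
        (by rw [conv_single, show m - 2 * m = -m by ring, div_mul_cancel₀ _ hEm])
        fun d _ _ => commutator_mem_commutator _ _
      rwa [conv_single, zero_sub] at h
    rcases exists_tuples_of_not_symmetric hp h0 hs hz with
      ⟨m, hm, hEm, y, hy0, hym, hyc, hyn⟩ | h3
    · exact H.kernel_le_of_commutator hEm hyn
        (H.commutator_aPow_mem_rigid hm hy0 hym hyc fun d _ _ => commutator_mem_commutator _ _)
        (hb m hm hEm)
    · push Not at hs
      obtain ⟨m, hne⟩ := hs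
      have hm : m ≠ 0 := by rintro rfl; simp at hne
      have hEm : E m ≠ 0 := fun h => hne (by rw [h, hz m h])
      have hEm' : E (-m) ≠ 0 := fun h => hEm (by simpa using hz _ h)
      have hx : ∀ x y : ZMod 3, x ≠ y → y ≠ 0 → x ≠ 0 → x = -y := by decide
      have hy : ∀ x : ZMod 3, -(2 * x) = x := by decide
      have hneg : E (-m) = -E m := by
        subst h3
        -- For p = 3 two distinct nonzero residues are negatives of each other, so `hb` at m and at
        -- -m gives the two relations for α = a^(E m).
        exact hx _ _ hne hEm hEm'
      have hmm : -(2 * m) = m := by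
        subst h3
        exact hy m
      have hmm' : -(2 * -m) = -m := by linear_combination -hmm
      have e1 := hb m hm hEm'
      have e2 := hb (-m) (neg_ne_zero.mpr hm) (by rwa [neg_neg])
      rw [hmm, hneg, div_self (neg_ne_zero.mpr hEm), one_mul] at e1
      rw [neg_neg, hmm', hneg, neg_neg, div_self hEm, one_mul] at e2
      have e3 := e2
      rw [← commute_mk_iff, map_commutatorElement, map_mul, D.aPow_neg, map_inv] at e1 e2
      have e4 := commute_of_pow_three (by
        rw [← map_pow, aPow, ← pow_mul, mul_comm, pow_mul, ← h3, D.a_pow, one_pow, map_one]) e2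
        (by simpa using e1)
      rw [← map_commutatorElement, commute_mk_iff] at e4
      exact H.kernel_le_of_commutator hEm hEm e4 e3
  · push Not at hz
    obtain ⟨m, hm0, hEm⟩ := hz
    have hm : m ≠ 0 := by rintro rfl; simp [h0] at hEm
    have hmem := D.commutator_mem_rigid (M := commutator Γ) hm hm0 (commutator_mem_commutator _ _)
    have hall : ∀ y, ⁅⁅D.b, D.aPow (E (-m))⁆, y⁆ ∈ D.rigid (commutator Γ) := by
      intro y
      rw [commutatorElement_def, mul_assoc, mul_assoc, ← mul_assoc y]
      exact mul_mem hmem (hR.conj_mem _ (inv_mem hmem) y)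
    exact H.kernel_le_of_commutator (s := 1) (s' := 0) hEm one_ne_zero (hall _) (hall _)

theorem kernel_le_rigid (hp : p ≠ 2) (h0 : E 0 = 0) (hE : ¬ ∃ u, ∀ m, m ≠ 0 → E m = u) :
    H.kernel ≤ D.rigid ⁅commutator Γ, commutator Γ⁆ := by
  have hE' : ∃ m, m ≠ 0 ∧ E m ≠ 0 := by
    by_contra! h
    exact hE ⟨0, h⟩
  by_cases hs : ∀ m, E (-m) = E m
  · exact H.kernel_le_rigid_of_symmetric hp hs hE hE'
  · exact H.kernel_le_rigid_of_commutator_mem hE hE'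
      (H.commutator_mem_rigid_of_not_symmetric h0 hs hE'
        (H.kernel_le_rigid_commutator hp h0 hs hE'))

end WreathRecursion.Heisenberg

open Classical in
/-- The index of the second derived subgroup of a group with a GGS-like wreath recursion. -/
theorem WreathRecursion.index_derivedSeries_two {p : ℕ} [Fact p.Prime] {E : ZMod p → ZMod p}
    {Γ : Type*} [Group Γ] (D : WreathRecursion p E Γ) (hp : p ≠ 2) (h0 : E 0 = 0)
    (hE : ¬ ∃ u, ∀ m, m ≠ 0 → E m = u) :
    (derivedSeries Γ 2).index * p ^ (if ∀ m, E (-m) = E m then 1 else 0) =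
      p ^ ((if ∃ u κ, ∀ m, m ≠ 0 → E m = u + κ * m then 1 else 0) +
        (if ∃ κ, ∀ m, E m - E (-m) = κ * m then 1 else 0)) * p ^ (p + 1) := by
  obtain ⟨H⟩ := D.nonempty_heisenberg h0 hE
  have hE' : ∃ m, E m ≠ 0 := by
    by_contra! h
    exact hE ⟨0, fun m _ => h m⟩
  rw [← index_commSpan_top h0 hE', ← index_commSpan_sumZero hp h0 hE]
  exact H.index_formula h0 fun g hg hρ => H.mem_of_rho_eq_zero h0 (H.kernel_le_rigid hp h0 hE) hg hρ

/-! ### From functions on `ZMod p` back to the defining tuple. -/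

section Entry

variable {p : ℕ} (e : Fin (p - 1) → ZMod p)

theorem entry_zero : entry e 0 = 0 := by
  unfold entry
  rw [dif_neg (by simp)]

variable [Fact p.Prime]

theorem entry_natCast {i : ℕ} (hi : i < p - 1) : entry e ((i + 1 : ℕ) : ZMod p) = e ⟨i, hi⟩ := by
  have hv : ((i + 1 : ℕ) : ZMod p).val = i + 1 := ZMod.val_natCast_of_lt (by omega)
  have h0 : ((i + 1 : ℕ) : ZMod p) ≠ 0 := natCast_ne_zero_of_lt (by omega) (by omega)
  unfold entry
  rw [dif_pos ⟨by rw [hv]; omega, h0⟩]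
  congr 1
  ext
  simp only [hv]
  omega

theorem entry_neg_natCast (i : Fin (p - 1)) :
    entry e (-((i + 1 : ℕ) : ZMod p)) = e i.rev := by
  have h : -((i + 1 : ℕ) : ZMod p) = (((i.rev : ℕ) + 1 : ℕ) : ZMod p) := by
    rw [neg_eq_iff_add_eq_zero, ← Nat.cast_add, Fin.val_rev]
    have := i.2
    have h2 : (i : ℕ) + 1 + (p - 1 - (i + 1) + 1) = p := by omega
    rw [h2, CharP.cast_eq_zero]
  rw [h, entry_natCast e i.rev.2]

theorem exists_eq_natCast_succ {k : ZMod p} (hk : k ≠ 0) :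
    ∃ i : Fin (p - 1), k = ((i + 1 : ℕ) : ZMod p) := by
  obtain ⟨n, hn, h⟩ := exists_eq_succ_mul (one_ne_zero (α := ZMod p)) hk
  exact ⟨⟨n, by omega⟩, by rw [h, mul_one]⟩

theorem isConstant_of_entry (h : ∃ u, ∀ m, m ≠ 0 → entry e m = u) : IsConstant e := by
  obtain ⟨u, hu⟩ := h
  have : ∀ i : Fin (p - 1), e i = u := fun i => by
    rw [← entry_natCast e i.2]
    exact hu _ (natCast_ne_zero_of_lt (by omega) (by omega))
  intro i j
  rw [this, this]

theorem isSymmetric_iff : IsSymmetric e ↔ ∀ m, entry e (-m) = entry e m := by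
  constructor
  · intro h m
    by_cases hm : m = 0
    · rw [hm, neg_zero]
    · obtain ⟨i, rfl⟩ := exists_eq_natCast_succ hm
      rw [entry_neg_natCast, entry_natCast e i.2]
      exact (h i).symm
  · intro h i
    rw [← entry_neg_natCast e i, h, entry_natCast e i.2]

theorem isConstant_diff_iff (hp : p ≠ 2) :
    IsConstant (diff e) ↔ ∃ u κ, ∀ m, m ≠ 0 → entry e m = u + κ * m := by
  have hp2 : 2 ≤ p := (Fact.out : p.Prime).two_le
  have hd : ∀ i : Fin (p - 1 - 1), diff e i =
      entry e ((i + 1 : ℕ) : ZMod p) - entry e ((i + 1 + 1 : ℕ) : ZMod p) := fun i => by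
    rw [entry_natCast e (by omega), entry_natCast e (by omega)]
    rfl
  constructor
  · intro h
    have hstep : ∀ i : ℕ, i + 1 < p - 1 → entry e ((i + 1 + 1 : ℕ) : ZMod p) =
        entry e ((i + 1 : ℕ) : ZMod p) - diff e ⟨0, by omega⟩ := by
      intro i hi
      rw [h ⟨0, by omega⟩ ⟨i, by omega⟩, hd]
      ring
    have hi : ∀ i : ℕ, i < p - 1 →
        entry e ((i + 1 : ℕ) : ZMod p) = entry e 1 - i * diff e ⟨0, by omega⟩ := by
      intro i
      induction i with
      | zero => intro _; simp
      | succ i ih =>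
        intro hi
        rw [hstep i hi, ih (by omega)]
        push_cast
        ring
    refine ⟨entry e 1 + diff e ⟨0, by omega⟩, -diff e ⟨0, by omega⟩, fun m hm => ?_⟩
    obtain ⟨i, rfl⟩ := exists_eq_natCast_succ hm
    rw [hi i i.2]
    push_cast
    ring
  · rintro ⟨u, κ, h⟩
    have : ∀ i, diff e i = -κ := fun i => by
      rw [hd, h _ (natCast_ne_zero_of_lt (by omega) (by omega)),
        h _ (natCast_ne_zero_of_lt (by omega) (by omega))]
      push_cast
      ring
    intro i j
    rw [this, this]

/-- Reversing the second differences of `e` replaces each argument of `entry e` by its negative. So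
symmetry says that the odd part `o` has vanishing second differences on 1, …, p-1, that is, `o` is
affine there; oddness at p-1 = -1 then forces `o 2 = 2 * o 1`, making `o` linear. -/
theorem isSymmetric_diff_diff_iff (hp : p ≠ 2) :
    IsSymmetric (diff (diff e)) ↔ ∃ κ, ∀ m, entry e m - entry e (-m) = κ * m := by
  have hp2 : 2 ≤ p := (Fact.out : p.Prime).two_le
  have h2 : (2 : ZMod p) ≠ 0 := by exact_mod_cast ZMod.prime_ne_zero p 2 hp
  have hd : ∀ i : Fin (p - 1 - 1 - 1), diff (diff e) i =
      entry e ((i + 1 : ℕ) : ZMod p) - 2 * entry e ((i + 1 + 1 : ℕ) : ZMod p) +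
        entry e ((i + 1 + 1 + 1 : ℕ) : ZMod p) := fun i => by
    rw [entry_natCast e (by omega), entry_natCast e (by omega), entry_natCast e (by omega)]
    simp only [diff]
    ring
  have hr : ∀ i : Fin (p - 1 - 1 - 1), diff (diff e) i.rev =
      entry e (-((i + 1 : ℕ) : ZMod p)) - 2 * entry e (-((i + 1 + 1 : ℕ) : ZMod p)) +
        entry e (-((i + 1 + 1 + 1 : ℕ) : ZMod p)) := fun i => by
    have hc : ((p - 1 - 1 - 1 - (i + 1) + 1 : ℕ) : ZMod p) = -((i + 1 + 1 + 1 : ℕ) : ZMod p) := by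
      rw [eq_neg_iff_add_eq_zero, ← Nat.cast_add]
      have := i.2
      have h3 : p - 1 - 1 - 1 - ((i : ℕ) + 1) + 1 + (i + 1 + 1 + 1) = p := by omega
      rw [h3, CharP.cast_eq_zero]
    rw [hd, Fin.val_rev]
    generalize p - 1 - 1 - 1 - ((i : ℕ) + 1) = x at hc
    have hc' : (x : ZMod p) = -(i + 1 + 1 + 1 + 1) := by
      push_cast at hc
      linear_combination hc
    push_cast
    rw [hc']
    ring_nf
  set o : ZMod p → ZMod p := fun m => entry e m - entry e (-m) with ho
  have hodd : ∀ m, o (-m) = -o m := fun m => by simp [ho]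
  have hsym : IsSymmetric (diff (diff e)) ↔ ∀ i : ℕ, i < p - 1 - 1 - 1 →
      o ((i + 1 + 1 + 1 : ℕ) : ZMod p) = 2 * o ((i + 1 + 1 : ℕ) : ZMod p) - o ((i + 1 : ℕ)) := by
    constructor
    · intro h i hi
      have := h ⟨i, hi⟩
      rw [hd, hr] at this
      simp only [ho]
      linear_combination this
    · intro h i
      have := h i i.2
      rw [hd, hr]
      simp only [ho] at this
      linear_combination this
  rw [hsym]
  change _ ↔ ∃ κ, ∀ m, o m = κ * m
  constructor
  · intro h
    have hi : ∀ i : ℕ, i + 1 < p - 1 → o ((i + 1 : ℕ) : ZMod p) = o 1 + i * (o 2 - o 1) ∧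
        o ((i + 1 + 1 : ℕ) : ZMod p) = o 1 + (i + 1) * (o 2 - o 1) := by
      intro i
      induction i with
      | zero => intro _; norm_num
      | succ i ih =>
        intro hi
        obtain ⟨h1, h2⟩ := ih (by omega)
        refine ⟨by rw [h2]; push_cast; ring, ?_⟩
        rw [h i (by omega), h1, h2]
        push_cast
        ring
    have hlast := (hi (p - 3) (by omega)).2
    have hc : ((p - 3 : ℕ) : ZMod p) = -3 := by
      rw [Nat.cast_sub (by omega), CharP.cast_eq_zero]
      norm_num
    have hneg : o ((p - 3 + 1 + 1 : ℕ) : ZMod p) = -o 1 := by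
      rw [← hodd]
      congr 1
      push_cast
      rw [hc]
      ring
    rw [hneg, hc] at hlast
    have ho1 : o 2 - o 1 = o 1 := by
      apply mul_left_cancel₀ h2
      linear_combination hlast
    refine ⟨o 1, fun m => ?_⟩
    by_cases hm : m = 0
    · simp [hm, ho]
    · obtain ⟨⟨i, hi'⟩, rfl⟩ := exists_eq_natCast_succ hm
      simp only
      cases i with
      | zero => simp
      | succ i =>
        rw [(hi i hi').2, ho1]
        push_cast
        ring
  · rintro ⟨κ, h⟩ i _
    rw [h, h, h]
    push_cast
    ring

end Entry

/-! ### The wreath recursion of the concrete GGS-group. -/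

section Realization

variable {p : ℕ} (e : Fin (p - 1) → ZMod p)

theorem genB_cons_of_ne {x : ZMod p} (hx : x ≠ 0) (v : List (ZMod p)) :
    genB e (x :: v) = x :: rooted (entry e x) v := by
  change directedFun e _ = _
  rw [directedFun, if_neg hx]

theorem genA_mem : genA p ∈ ggsGroup e := Subgroup.subset_closure (by simp)

theorem genB_mem : genB e ∈ ggsGroup e := Subgroup.subset_closure (by simp)

/-- The first-level decomposition of an element of the group. -/
def IsDecomposition (g : TreeAut p) (r : ZMod p) (s : ZMod p → ggsGroup e) : Prop :=
  g [] = [] ∧ ∀ k v, g (k :: v) = (k + r) :: (s k : TreeAut p) v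

variable {e}

theorem IsDecomposition.unique {g : TreeAut p} {r r' : ZMod p} {s s' : ZMod p → ggsGroup e}
    (h : IsDecomposition e g r s) (h' : IsDecomposition e g r' s') : r = r' ∧ s = s' := by
  have hk : ∀ k v, (k + r) :: (s k : TreeAut p) v = (k + r') :: (s' k : TreeAut p) v :=
    fun k v => (h.2 k v).symm.trans (h'.2 k v)
  refine ⟨add_left_cancel (List.cons_eq_cons.mp (hk 0 [])).1, funext fun k => Subtype.ext ?_⟩
  ext1 v
  exact (List.cons_eq_cons.mp (hk k v)).2

theorem IsDecomposition.mul {g h : TreeAut p} {r t : ZMod p} {s u : ZMod p → ggsGroup e}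
    (hg : IsDecomposition e g r s) (hh : IsDecomposition e h t u) :
    IsDecomposition e (g * h) (r + t) (fun k => s (k + t) * u k) := by
  refine ⟨?_, fun k v => ?_⟩
  · change g (h []) = []
    rw [hh.1, hg.1]
  · change g (h (k :: v)) = _
    rw [hh.2, hg.2, add_assoc, add_comm t r]
    rfl

theorem isDecomposition_one : IsDecomposition e 1 0 1 :=
  ⟨rfl, fun k v => by rw [add_zero]; rfl⟩

theorem isDecomposition_genA : IsDecomposition e (genA p) 1 1 := ⟨rfl, fun _ _ => rfl⟩

variable [Fact p.Prime]

variable (e) in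
theorem isDecomposition_genB : IsDecomposition e (genB e) 0 (fun k => if k = 0 then
    ⟨genB e, genB_mem e⟩ else ⟨genA p, genA_mem e⟩ ^ (entry e k).val) := by
  refine ⟨rfl, fun k v => ?_⟩
  simp only
  by_cases hk : k = 0
  · subst hk
    rw [genB_cons_zero, if_pos rfl, add_zero]
  · rw [genB_cons_of_ne e hk, if_neg hk, add_zero, SubmonoidClass.coe_pow, ← rooted_natCast,
      ZMod.natCast_zmod_val]

theorem exists_isDecomposition (g : ggsGroup e) : ∃ r s, IsDecomposition e (g : TreeAut p) r s := by
  obtain ⟨g, hg⟩ := g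
  change ∃ r s, IsDecomposition e g r s
  unfold ggsGroup at hg
  induction hg using Subgroup.closure_induction with
  | mem x hx =>
    rcases hx with rfl | rfl
    · exact ⟨_, _, isDecomposition_genA⟩
    · exact ⟨_, _, isDecomposition_genB e⟩
  | one => exact ⟨_, _, isDecomposition_one⟩
  | mul x y _ _ hx hy =>
    obtain ⟨r, s, hx⟩ := hx
    obtain ⟨t, u, hy⟩ := hy
    exact ⟨_, _, hx.mul hy⟩
  | inv x _ hx =>
    obtain ⟨r, s, h1, h2⟩ := hx
    have hinv : ∀ w, x⁻¹ (x w) = w := fun w => x.symm_apply_apply w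
    refine ⟨-r, fun k => (s (k - r))⁻¹, ?_, fun k v => ?_⟩
    · have := hinv []
      rwa [h1] at this
    · have := hinv ((k - r) :: ((s (k - r) : TreeAut p))⁻¹ v)
      rw [h2, sub_add_cancel] at this
      rw [← sub_eq_add_neg]
      have e1 : (s (k - r) : TreeAut p) ((s (k - r) : TreeAut p)⁻¹ v) = v :=
        (s (k - r) : TreeAut p).apply_symm_apply v
      rw [e1] at this
      exact this

theorem genA_pow_prime : genA p ^ p = 1 := by
  rw [← rooted_natCast, CharP.cast_eq_zero]
  ext1 u
  exact shiftFun_zero u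

theorem genB_pow_prime : genB e ^ p = 1 := by
  have hpow : ∀ (n : ℕ) (x : ZMod p) (v : List (ZMod p)), (genB e ^ n) (x :: v) =
      if x = 0 then x :: (genB e ^ n) v else x :: (rooted (entry e x) ^ n) v := by
    intro n
    induction n with
    | zero => intro x v; simp
    | succ n ih =>
      intro x v
      rw [pow_succ']
      change genB e ((genB e ^ n) (x :: v)) = _
      rw [ih]
      by_cases hx : x = 0
      · rw [if_pos hx, if_pos hx, hx, genB_cons_zero]
        rfl
      · rw [if_neg hx, if_neg hx, genB_cons_of_ne e hx, pow_succ']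
        rfl
  have hnil : ∀ n : ℕ, (genB e ^ n) [] = [] := by
    intro n
    induction n with
    | zero => rfl
    | succ n ih =>
      rw [pow_succ']
      change genB e ((genB e ^ n) []) = _
      rw [ih]
      rfl
  ext1 u
  change (genB e ^ p) u = u
  induction u with
  | nil => exact hnil p
  | cons x v ih =>
    rw [hpow]
    split_ifs
    · rw [ih]
    · have : rooted (entry e x) ^ p = 1 := by
        rw [← ZMod.natCast_zmod_val (entry e x), rooted_natCast, ← pow_mul, mul_comm, pow_mul,
          genA_pow_prime, one_pow]
      rw [this]
      rfl

/-- The action of an element of the group on the first letters. -/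
noncomputable def rootOf (g : ggsGroup e) : ZMod p := (exists_isDecomposition g).choose

/-- The sections of an element of the group at the letters. -/
noncomputable def secOf (g : ggsGroup e) : ZMod p → ggsGroup e :=
  (exists_isDecomposition g).choose_spec.choose

theorem isDecomposition_rootOf (g : ggsGroup e) : IsDecomposition e g (rootOf g) (secOf g) :=
  (exists_isDecomposition g).choose_spec.choose_spec

variable (e) in
/-- The wreath recursion of a GGS-group. -/
noncomputable def wreathRecursion : WreathRecursion p (entry e) (ggsGroup e) where
  a := ⟨genA p, genA_mem e⟩
  b := ⟨genB e, genB_mem e⟩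
  root := rootOf
  sec := secOf
  root_mul g h := ((isDecomposition_rootOf (g * h)).unique
    ((isDecomposition_rootOf g).mul (isDecomposition_rootOf h))).1
  sec_mul g h := congrFun ((isDecomposition_rootOf (g * h)).unique
    ((isDecomposition_rootOf g).mul (isDecomposition_rootOf h))).2
  faithful g hr hs := by
    have hd := isDecomposition_rootOf g
    refine Subtype.ext ?_
    ext1 u
    change (g : TreeAut p) u = u
    cases u with
    | nil => exact hd.1
    | cons k v =>
      rw [hd.2, hr, hs, add_zero]
      rfl
  root_a := ((isDecomposition_rootOf ⟨genA p, genA_mem e⟩).unique isDecomposition_genA).1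
  sec_a := congrFun ((isDecomposition_rootOf ⟨genA p, genA_mem e⟩).unique isDecomposition_genA).2
  root_b := ((isDecomposition_rootOf ⟨genB e, genB_mem e⟩).unique (isDecomposition_genB e)).1
  sec_b_zero := by
    have := congrFun
      ((isDecomposition_rootOf ⟨genB e, genB_mem e⟩).unique (isDecomposition_genB e)).2 0
    rwa [if_pos rfl] at this
  sec_b k hk := by
    have := congrFun
      ((isDecomposition_rootOf ⟨genB e, genB_mem e⟩).unique (isDecomposition_genB e)).2 k
    rwa [if_neg hk] at this
  closure_eq := by
    apply Subgroup.map_injective (ggsGroup e).subtype_injective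
    rw [MonoidHom.map_closure, Set.image_pair, ← MonoidHom.range_eq_map, Subgroup.range_subtype]
    rfl
  a_pow := Subtype.ext genA_pow_prime
  b_pow := Subtype.ext genB_pow_prime

end Realization

end GGS

/-! ### The main theorem. -/

theorem mainTheorem3 (p : ℕ) [Fact p.Prime] (hp : Odd p) (e : Fin (p - 1) → ZMod p)
    (he : ¬ GGS.IsConstant e) :
    (derivedSeries (GGS.ggsGroup e) 2).FiniteIndex ∧
      Real.logb p ((derivedSeries (GGS.ggsGroup e) 2).index : ℝ) =
        (p : ℝ) + 1 + (GGS.con (GGS.diff e) : ℝ) + (GGS.sym (GGS.diff (GGS.diff e)) : ℝ)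
          - (GGS.sym e : ℝ) := by
  have hp2 : p ≠ 2 := by
    rintro rfl
    exact absurd hp (by decide)
  have hpos : 1 < p := (Fact.out : p.Prime).one_lt
  have h : (derivedSeries (GGS.ggsGroup e) 2).index * p ^ GGS.sym e =
      p ^ (GGS.con (GGS.diff e) + GGS.sym (GGS.diff (GGS.diff e))) * p ^ (p + 1) := by
    simp only [GGS.sym, GGS.con, GGS.isSymmetric_iff e, GGS.isConstant_diff_iff e hp2,
      GGS.isSymmetric_diff_diff_iff e hp2]
    convert (GGS.wreathRecursion e).index_derivedSeries_two hp2 (GGS.entry_zero e)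
      (mt (GGS.isConstant_of_entry e) he)
  rw [← pow_add] at h
  -- An infinite index is 0 by convention, which would make a power of p vanish.
  have hne : (derivedSeries (GGS.ggsGroup e) 2).index ≠ 0 := by
    intro h0
    rw [h0, zero_mul] at h
    exact pow_ne_zero _ (by omega) h.symm
  refine ⟨⟨hne⟩, ?_⟩
  have hpR : (1 : ℝ) < p := by exact_mod_cast hpos
  have h1 := congrArg (fun n : ℕ => Real.logb p (n : ℝ)) h
  simp only [Nat.cast_mul, Nat.cast_pow] at h1
  rw [Real.logb_mul (by exact_mod_cast hne) (by positivity), Real.logb_pow, Real.logb_pow,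
    Real.logb_self_eq_one hpR] at h1
  push_cast at h1
  linear_combination h1
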